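/- Let $k$ be a commutative unital ring; algebras are associative unital $k$-algebras. Let $\mathcal H=(\mathcal H_L,\mathcal H_R,S)$ be a Hopf algebroid over $k$: a left bialgebroid $\mathcal H_L=(H,L,s_L,t_L,\gamma_L,\pi_L)$ and a right bialgebroid $\mathcal H_R=(H,R,s_R,t_R,\gamma_R,\pi_R)$ on the same total algebra $H$, where $H$ is an $L$-bimodule by $l\,h\,l'=s_L(l)t_L(l')h$ and an $R$-bimodule by $r\,h\,r'=h\,s_R(r')t_R(r)$, such that $$s_L\pi_Lt_R=t_R,\quad t_L\pi_Ls_R=s_R,\quad s_R\pi_Rt_L=t_L,\quad t_R\pi_Rs_L=s_L,$$ $$(\gamma_L\otimes_R H)\gamma_R=(H\otimes_L\gamma_R)\gamma_L,\qquad (\gamma_R\otimes_L H)\gamma_L=(H\otimes_R\gamma_L)\gamma_R,$$ together with a $k$-linear map $S:H\to H$ (the antipode) satisfying $S(t_L(l)\,h\,t_R(r))=s_R(r)S(h)s_L(l)$, $S(t_R(r)\,h\,t_L(l))=s_L(l)S(h)s_R(r)$, $\mu_H(S\otimes_L H)\gamma_L=s_R\pi_R$ and $\mu_H(H\otimes_R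 S)\gamma_R=s_L\pi_L$. No bijectivity of $S$, and no flatness or projectivity, is assumed. A right $\mathcal H$-comodule is a right $R$- and right $L$-module $M$ with a right $\mathcal H_R$-coaction $\varrho_R:M\to M\otimes_R H$ and a right $\mathcal H_L$-coaction $\varrho_L:M\to M\otimes_L H$ such that $\varrho_R$ is right $L$-linear, $\varrho_L$ is right $R$-linear, $(M\otimes_R\gamma_L)\varrho_R=(\varrho_R\otimes_L H)\varrho_L$ and $(M\otimes_L\gamma_R)\varrho_L=(\varrho_L\otimes_R H)\varrho_R$. A map is right $\mathcal H$-colinear if it is a comodule map for both $\mathcal H_R$ and $\mathcal H_L$. A right $\mathcal H$-comodule algebra is a monoid $A$ in the monoidal category of right $\mathcal H$-comodules; in particular it is an $R$-ring, with unit map $\eta_R:R\to A$. Write $\varrho_R(a)=a^{[0]}\otimes_R a^{[1]}$. Let $A$ be a right $\mathcal H$-comodule algebra and $B=\{b\in A\mid \varrho_R(b)=b\otimes_R 1_H\}$ (so $B\subseteq A$ is a right $\mathcal H$-extension). * The extension is $\mathcal H_R$-Galois if the map $A\otimes_BA\to A\otimes_RH$, $a\otimes a'\mapsto aa'^{[0]}\otimes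 a'^{[1]}$, is bijective. * Let $\eta_L:L\to A$ be an algebra map with image in $B$, i.e. an $L$-ring structure on $A$ for which $B$ is an $L$-subring. A cleaving map with respect to $\eta_L$ is a left $L$-linear, right $\mathcal H$-colinear map $j:H\to A$ (hence $j(s_L(l)\,h\,s_R(r))=\eta_L(l)j(h)\eta_R(r)$) that is convolution invertible: there is a $k$-linear map $\tilde\jmath:H\to A$ with $\tilde\jmath(t_L(l)\,h\,t_R(r))=\eta_R(r)\tilde\jmath(h)\eta_L(l)$, $\mu_A(j\otimes_R\tilde\jmath)\gamma_R=\eta_L\pi_L$ and $\mu_A(\tilde\jmath\otimes_L j)\gamma_L=\eta_R\pi_R$. The extension is $\mathcal H$-cleft if there are such an $\eta_L$ and a cleaving map with respect to it. * Given $\eta_L$, the module $B\otimes_LH$ (with $b\,\eta_L(l)\otimes h=b\otimes s_L(l)h$) is a left $B$-module through the first factor and a right $\mathcal H$-comodule with coactions $B\otimes_L\gamma_R$ and $B\otimes_L\gamma_L$. **Theorem.** The following statements are equivalent: 1. The extension $B\subseteq A$ is $\mathcal H$-cleft. 2. (a) The extension $B\subseteq A$ is $\mathcal H_R$-Galois,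 and (b) for some algebra map $\eta_L:L\to B$ there is an isomorphism $A\simeq B\otimes_LH$ of left $B$-modules and right $\mathcal H$-comodules. Moreover the equivalence holds for each fixed $L$-ring structure: for every algebra map $\eta_L:L\to B$ there is a cleaving map with respect to $\eta_L$ if and only if $B\subseteq A$ is $\mathcal H_R$-Galois and $A\simeq B\otimes_LH$ as left $B$-modules and right $\mathcal H$-comodules, with $B\otimes_L H$ formed by means of $\eta_L$. -/

import Mathlib

open scoped TensorProduct
open MulOpposite

noncomputable section

namespace HopfCleft

/-! ### Modules over noncommutative `k`-algebras and their balanced tensor products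

A left (right) module structure over a `k`-algebra `P` on a `k`-module `M` is given by its
action map, an algebra homomorphism from `P` (from the opposite of `P`) to `End_k M`.  This allows
several module structures over the same algebra on one `k`-module. -/

section Tensor

/-- A left `P`-module structure on the `k`-module `M`. -/
abbrev LeftAct (k P M : Type*) [CommRing k] [Ring P] [Algebra k P] [AddCommGroup M] [Module k M] :=
  P →ₐ[k] Module.End k M

/-- A right `P`-module structure on the `k`-module `M`: `a (op p) m` is `m p`. -/
abbrev RightAct (k P M : Type*) [CommRing k] [Ring P] [Algebra k P] [AddCommGroup M] [Module k M] :=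
  Pᵐᵒᵖ →ₐ[k] Module.End k M

/-- A `P`-`Q`-bimodule structure on the `k`-module `M`. -/
structure Bimod (k P Q M : Type*) [CommRing k] [Ring P] [Algebra k P] [Ring Q] [Algebra k Q]
    [AddCommGroup M] [Module k M] where
  left : LeftAct k P M
  right : RightAct k Q M
  comm : ∀ (p : P) (q : Qᵐᵒᵖ) (m : M), left p (right q m) = right q (left p m)

variable {k P Q M N K M' N' T : Type*} [CommRing k] [Ring P] [Algebra k P] [Ring Q] [Algebra k Q]
  [Ring T] [Algebra k T]
  [AddCommGroup M] [Module k M] [AddCommGroup N] [Module k N] [AddCommGroup K] [Module k K]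
  [AddCommGroup M'] [Module k M'] [AddCommGroup N'] [Module k N']

/-- The `k`-submodule of `M ⊗ₖ N` generated by all `m p ⊗ n - m ⊗ p n`. -/
def balancedRel (a : RightAct k P M) (b : LeftAct k P N) : Submodule k (M ⊗[k] N) :=
  Submodule.span k {x | ∃ (m : M) (p : P) (n : N), x = a (op p) m ⊗ₜ[k] n - m ⊗ₜ[k] b p n}

/-- The tensor product `M ⊗_P N` of a right and a left `P`-module. -/
def BTensor (a : RightAct k P M) (b : LeftAct k P N) : Type _ :=
  (M ⊗[k] N) ⧸ balancedRel a b

instance (a : RightAct k P M) (b : LeftAct k P N) : AddCommGroup (BTensor a b) :=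
  inferInstanceAs (AddCommGroup ((M ⊗[k] N) ⧸ balancedRel a b))

instance (a : RightAct k P M) (b : LeftAct k P N) : Module k (BTensor a b) :=
  inferInstanceAs (Module k ((M ⊗[k] N) ⧸ balancedRel a b))

/-- The canonical epimorphism `M ⊗ₖ N → M ⊗_P N`. -/
def quo (a : RightAct k P M) (b : LeftAct k P N) : M ⊗[k] N →ₗ[k] BTensor a b :=
  (balancedRel a b).mkQ

/-- The canonical bilinear map `M × N → M ⊗_P N`. -/
def tmul (a : RightAct k P M) (b : LeftAct k P N) : M →ₗ[k] N →ₗ[k] BTensor a b :=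
  (TensorProduct.mk k M N).compr₂ (quo a b)

theorem quo_surjective (a : RightAct k P M) (b : LeftAct k P N) :
    Function.Surjective (quo a b) :=
  Submodule.mkQ_surjective _

@[simp]
theorem quo_tmul (a : RightAct k P M) (b : LeftAct k P N) (m : M) (n : N) :
    quo a b (m ⊗ₜ n) = tmul a b m n := rfl

theorem tmul_balanced (a : RightAct k P M) (b : LeftAct k P N) (m : M) (p : P) (n : N) :
    tmul a b (a (op p) m) n = tmul a b m (b p n) := by
  rw [← quo_tmul, ← quo_tmul, ← sub_eq_zero, ← map_sub]
  exact (Submodule.Quotient.mk_eq_zero _).2 (Submodule.subset_span ⟨m, p, n, rfl⟩)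

theorem tensor_ext {a : RightAct k P M} {b : LeftAct k P N} {f g : BTensor a b →ₗ[k] K}
    (h : ∀ m n, f (tmul a b m n) = g (tmul a b m n)) : f = g := by
  apply Submodule.linearMap_qext
  apply TensorProduct.ext'
  exact h

theorem tensor_ext_apply {a : RightAct k P M} {b : LeftAct k P N} (f g : BTensor a b →ₗ[k] K)
    (h : ∀ m n, f (tmul a b m n) = g (tmul a b m n)) (x : BTensor a b) : f x = g x := by
  rw [tensor_ext h]

/-- The map `M ⊗_P N → K` induced by a `P`-balanced bilinear map. -/
def lift (a : RightAct k P M) (b : LeftAct k P N) (f : M →ₗ[k] N →ₗ[k] K)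
    (hf : ∀ m p n, f (a (op p) m) n = f m (b p n)) : BTensor a b →ₗ[k] K :=
  (balancedRel a b).liftQ (TensorProduct.lift f) (by
    rw [balancedRel, Submodule.span_le]
    rintro _ ⟨m, p, n, rfl⟩
    simp [hf])

@[simp]
theorem lift_tmul (a : RightAct k P M) (b : LeftAct k P N) (f : M →ₗ[k] N →ₗ[k] K)
    (hf : ∀ m p n, f (a (op p) m) n = f m (b p n)) (m : M) (n : N) :
    lift a b f hf (tmul a b m n) = f m n := by
  change TensorProduct.lift f (m ⊗ₜ n) = f m n
  simp

/-- The map `f ⊗_P g` for a right `P`-linear map `f` and a left `P`-linear map `g`. -/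
def map {a : RightAct k P M} {b : LeftAct k P N} {a' : RightAct k P M'} {b' : LeftAct k P N'}
    (f : M →ₗ[k] M') (g : N →ₗ[k] N') (hf : ∀ p m, f (a (op p) m) = a' (op p) (f m))
    (hg : ∀ p n, g (b p n) = b' p (g n)) : BTensor a b →ₗ[k] BTensor a' b' :=
  lift a b ((tmul a' b').compl₁₂ f g) (by
    intro m p n
    simp [hf, hg, tmul_balanced])

@[simp]
theorem map_tmul {a : RightAct k P M} {b : LeftAct k P N} {a' : RightAct k P M'}
    {b' : LeftAct k P N'} (f : M →ₗ[k] M') (g : N →ₗ[k] N')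
    (hf : ∀ p m, f (a (op p) m) = a' (op p) (f m))
    (hg : ∀ p n, g (b p n) = b' p (g n)) (m : M) (n : N) :
    map f g hf hg (tmul a b m n) = tmul a' b' (f m) (g n) := by
  simp [map]

/-- An action of an algebra `T` on `M` that commutes with the right `P`-action induces an action
on the first tensor factor of `M ⊗_P N`. -/
def actFst (a : RightAct k P M) (b : LeftAct k P N) (c : T →ₐ[k] Module.End k M)
    (h : ∀ t p m, c t (a p m) = a p (c t m)) : T →ₐ[k] Module.End k (BTensor a b) :=
  AlgHom.ofLinearMap
    { toFun := fun t => map (c t) LinearMap.id (fun p m => h t (op p) m) (fun _ _ => rfl)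
      map_add' := fun s t => tensor_ext fun m n => by simp
      map_smul' := fun s t => tensor_ext fun m n => by simp }
    (tensor_ext fun m n => by simp)
    (fun s t => tensor_ext fun m n => by simp)

@[simp]
theorem actFst_tmul (a : RightAct k P M) (b : LeftAct k P N) (c : T →ₐ[k] Module.End k M)
    (h : ∀ t p m, c t (a p m) = a p (c t m)) (t : T) (m : M) (n : N) :
    actFst a b c h t (tmul a b m n) = tmul a b (c t m) n := by
  simp [actFst]

/-- An action of an algebra `T` on `N` that commutes with the left `P`-action induces an action
on the second tensor factor of `M ⊗_P N`. -/
def actSnd (a : RightAct k P M) (b : LeftAct k P N) (c : T →ₐ[k] Module.End k N)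
    (h : ∀ t p n, c t (b p n) = b p (c t n)) : T →ₐ[k] Module.End k (BTensor a b) :=
  AlgHom.ofLinearMap
    { toFun := fun t => map LinearMap.id (c t) (fun _ _ => rfl) (h t)
      map_add' := fun s t => tensor_ext fun m n => by simp
      map_smul' := fun s t => tensor_ext fun m n => by simp }
    (tensor_ext fun m n => by simp)
    (fun s t => tensor_ext fun m n => by simp)

@[simp]
theorem actSnd_tmul (a : RightAct k P M) (b : LeftAct k P N) (c : T →ₐ[k] Module.End k N)
    (h : ∀ t p n, c t (b p n) = b p (c t n)) (t : T) (m : M) (n : N) :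
    actSnd a b c h t (tmul a b m n) = tmul a b m (c t n) := by
  simp [actSnd]

/-- The right `Q`-module `M ⊗_P N` for a `P`-`Q`-bimodule `N`. -/
def rightOn (a : RightAct k P M) (X : Bimod k P Q N) : RightAct k Q (BTensor a X.left) :=
  actSnd a X.left X.right fun q p n => (X.comm p q n).symm

/-- The left `P`-module `M ⊗_Q N` for a `P`-`Q`-bimodule `M`. -/
def leftOn (X : Bimod k P Q M) (b : LeftAct k Q N) : LeftAct k P (BTensor X.right b) :=
  actFst X.right b X.left X.comm

@[simp]
theorem rightOn_tmul (a : RightAct k P M) (X : Bimod k P Q N) (q : Qᵐᵒᵖ) (m : M) (n : N) :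
    rightOn a X q (tmul a X.left m n) = tmul a X.left m (X.right q n) := by
  simp [rightOn]

@[simp]
theorem leftOn_tmul (X : Bimod k P Q M) (b : LeftAct k Q N) (p : P) (m : M) (n : N) :
    leftOn X b p (tmul X.right b m n) = tmul X.right b (X.left p m) n := by
  simp [leftOn]

theorem tensor_induction {a : RightAct k P M} {b : LeftAct k P N} {motive : BTensor a b → Prop}
    (zero : motive 0) (tmul : ∀ m n, motive (tmul a b m n))
    (add : ∀ x y, motive x → motive y → motive (x + y)) (x : BTensor a b) : motive x := by
  obtain ⟨z, rfl⟩ := quo_surjective a b x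
  induction z with
  | zero => simpa using zero
  | tmul m n => exact tmul m n
  | add u v hu hv => rw [map_add]; exact add _ _ hu hv

/-- The map `(m ⊗ n, x) ↦ m ⊗ (n ⊗ x)`. -/
def assocFwd (a : RightAct k P M) (X : Bimod k P Q N) (b : LeftAct k Q K) :
    BTensor a X.left →ₗ[k] K →ₗ[k] BTensor a (leftOn X b) :=
  lift a X.left
    (LinearMap.mk₂ k (fun m n => (tmul a (leftOn X b) m) ∘ₗ (tmul X.right b n))
      (by intros; ext; simp) (by intros; ext; simp) (by intros; ext; simp)
      (by intros; ext; simp))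
    (by
      intro m p n
      ext x
      simp [tmul_balanced, ← leftOn_tmul])

@[simp]
theorem assocFwd_tmul (a : RightAct k P M) (X : Bimod k P Q N) (b : LeftAct k Q K)
    (m : M) (n : N) (x : K) :
    assocFwd a X b (tmul a X.left m n) x = tmul a (leftOn X b) m (tmul X.right b n x) := by
  simp [assocFwd]

/-- The map `(m, n ⊗ x) ↦ (m ⊗ n) ⊗ x`. -/
def assocBwd (a : RightAct k P M) (X : Bimod k P Q N) (b : LeftAct k Q K) :
    M →ₗ[k] BTensor X.right b →ₗ[k] BTensor (rightOn a X) b :=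
  LinearMap.flip (lift X.right b
    (LinearMap.mk₂ k (fun n x =>
        (LinearMap.flip (tmul (rightOn a X) b) x) ∘ₗ (LinearMap.flip (tmul a X.left) n))
      (by intros; ext; simp) (by intros; ext; simp) (by intros; ext; simp)
      (by intros; ext; simp))
    (by
      intro n q x
      ext m
      simp [← tmul_balanced]))

@[simp]
theorem assocBwd_tmul (a : RightAct k P M) (X : Bimod k P Q N) (b : LeftAct k Q K)
    (m : M) (n : N) (x : K) :
    assocBwd a X b m (tmul X.right b n x) = tmul (rightOn a X) b (tmul a X.left m n) x := by
  simp [assocBwd]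

theorem tmul_right_linear (a : RightAct k P M) (X : Bimod k P Q N) (m : M) (q : Q) (n : N) :
    tmul a X.left m (X.right (op q) n) = rightOn a X (op q) (tmul a X.left m n) := by
  simp

/-- The canonical isomorphism `(M ⊗_P N) ⊗_Q K ≃ M ⊗_P (N ⊗_Q K)`,
`(m ⊗ n) ⊗ x ↦ m ⊗ (n ⊗ x)`. -/
def assoc (a : RightAct k P M) (X : Bimod k P Q N) (b : LeftAct k Q K) :
    BTensor (rightOn a X) b ≃ₗ[k] BTensor a (leftOn X b) :=
  LinearEquiv.ofLinearMap
    (lift (rightOn a X) b (assocFwd a X b) (by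
      intro y q x
      induction y using tensor_induction with
      | zero => simp
      | tmul m n => simp [tmul_balanced]
      | add u v hu hv => simp only [map_add, LinearMap.add_apply, hu, hv]))
    (lift a (leftOn X b) (assocBwd a X b) (by
      intro m p y
      induction y using tensor_induction with
      | zero => simp
      | tmul n x => simp [tmul_balanced]
      | add u v hu hv => simp only [map_add, hu, hv]))
    (tensor_ext fun m y => by
      induction y using tensor_induction with
      | zero => simp
      | tmul n x => simp
      | add u v hu hv => simp only [map_add, hu, hv])
    (tensor_ext fun y x => by
      induction y using tensor_induction with
      | zero => simp
      | tmul m n => simp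
      | add u v hu hv => simp only [map_add, LinearMap.add_apply, hu, hv])

@[simp]
theorem assoc_tmul (a : RightAct k P M) (X : Bimod k P Q N) (b : LeftAct k Q K)
    (m : M) (n : N) (x : K) :
    assoc a X b (tmul (rightOn a X) b (tmul a X.left m n) x)
      = tmul a (leftOn X b) m (tmul X.right b n x) := by
  simp [assoc]

end Tensor


section MapLemmas

variable {k P Q M N K M' N' M'' N'' : Type*} [CommRing k] [Ring P] [Algebra k P]
  [Ring Q] [Algebra k Q]
  [AddCommGroup M] [Module k M] [AddCommGroup N] [Module k N] [AddCommGroup K] [Module k K]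
  [AddCommGroup M'] [Module k M'] [AddCommGroup N'] [Module k N']
  [AddCommGroup M''] [Module k M''] [AddCommGroup N''] [Module k N'']

theorem map_map {a : RightAct k P M} {b : LeftAct k P N} {a' : RightAct k P M'}
    {b' : LeftAct k P N'} {a'' : RightAct k P M''} {b'' : LeftAct k P N''}
    (f : M →ₗ[k] M') (g : N →ₗ[k] N') (hf : ∀ p m, f (a (op p) m) = a' (op p) (f m))
    (hg : ∀ p n, g (b p n) = b' p (g n))
    (f' : M' →ₗ[k] M'') (g' : N' →ₗ[k] N'') (hf' : ∀ p m, f' (a' (op p) m) = a'' (op p) (f' m))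
    (hg' : ∀ p n, g' (b' p n) = b'' p (g' n)) (x : BTensor a b) :
    map f' g' hf' hg' (map f g hf hg x)
      = map (a := a) (b := b) (a' := a'') (b' := b'') (f' ∘ₗ f) (g' ∘ₗ g)
          (by intros; simp [hf, hf']) (by intros; simp [hg, hg']) x := by
  induction x using tensor_induction with
  | zero => simp
  | tmul m n => simp
  | add u v hu hv => simp only [map_add, hu, hv]

theorem assoc_symm_tmul (a : RightAct k P M) (X : Bimod k P Q N) (b : LeftAct k Q K)
    (m : M) (y : BTensor X.right b) :
    (assoc a X b).symm (tmul a (leftOn X b) m y)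
      = map (a := X.right) (b := b) (a' := rightOn a X) (b' := b) (tmul a X.left m) LinearMap.id
          (tmul_right_linear a X m) (fun _ _ => rfl) y := by
  rw [LinearEquiv.symm_apply_eq]
  induction y using tensor_induction with
  | zero => simp
  | tmul m n => simp
  | add u v hu hv => simp only [map_add, ← hu, ← hv]

end MapLemmas

/-! ### Corings and their comodules -/

section Corings

variable {k P Q C M N B : Type*} [CommRing k] [Ring P] [Algebra k P] [Ring Q] [Algebra k Q]
  [AddCommGroup C] [Module k C] [AddCommGroup M] [Module k M] [AddCommGroup N] [Module k N]
  [AddCommGroup B] [Module k B]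

/-- The map `(c, m) ↦ ε(c) m`. -/
def leftEval (b : LeftAct k P M) (ε : C →ₗ[k] P) : C →ₗ[k] M →ₗ[k] M :=
  LinearMap.mk₂ k (fun c m => b (ε c) m) (by intros; simp) (by intros; simp) (by intros; simp)
    (by intros; simp)

/-- The map `(m, c) ↦ m ε(c)`. -/
def rightEval (a : RightAct k P M) (ε : C →ₗ[k] P) : M →ₗ[k] C →ₗ[k] M :=
  LinearMap.mk₂ k (fun m c => a (op (ε c)) m) (by intros; simp) (by intros; simp)
    (by intros; simp) (by intros; simp)

@[simp]
theorem leftEval_apply (b : LeftAct k P M) (ε : C →ₗ[k] P) (c : C) (m : M) :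
    leftEval b ε c m = b (ε c) m := rfl

@[simp]
theorem rightEval_apply (a : RightAct k P M) (ε : C →ₗ[k] P) (m : M) (c : C) :
    rightEval a ε m c = a (op (ε c)) m := rfl

theorem leftEval_balanced (X : Bimod k P Q C) (b : LeftAct k Q M) (ε : C →ₗ[k] Q)
    (hε : ∀ q c, ε (X.right (op q) c) = ε c * q) (c : C) (q : Q) (m : M) :
    leftEval b ε (X.right (op q) c) m = leftEval b ε c (b q m) := by
  simp [hε]

theorem rightEval_balanced (a : RightAct k P M) (X : Bimod k P Q C) (ε : C →ₗ[k] P)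
    (hε : ∀ p c, ε (X.left p c) = p * ε c) (m : M) (p : P) (c : C) :
    rightEval a ε (a (op p) m) c = rightEval a ε m (X.left p c) := by
  simp [hε]

/-- A `P`-coring structure on the `P`-bimodule `C`: a comonoid in the category of
`P`-bimodules. -/
structure Coring (X : Bimod k P P C) where
  Δ : C →ₗ[k] BTensor X.right X.left
  ε : C →ₗ[k] P
  Δ_left : ∀ p c, Δ (X.left p c) = leftOn X X.left p (Δ c)
  Δ_right : ∀ p c, Δ (X.right (op p) c) = rightOn X.right X (op p) (Δ c)
  ε_left : ∀ p c, ε (X.left p c) = p * ε c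
  ε_right : ∀ p c, ε (X.right (op p) c) = ε c * p
  coassoc : ∀ c, assoc X.right X X.left (map Δ LinearMap.id Δ_right (fun _ _ => rfl) (Δ c))
    = map LinearMap.id Δ (fun _ _ => rfl) Δ_left (Δ c)
  /-- `ε(c₍₁₎) c₍₂₎ = c` -/
  counit_left : ∀ c, lift X.right X.left (leftEval X.left ε)
    (leftEval_balanced X X.left ε ε_right) (Δ c) = c
  /-- `c₍₁₎ ε(c₍₂₎) = c` -/
  counit_right : ∀ c, lift X.right X.left (rightEval X.right ε)
    (rightEval_balanced X.right X ε ε_left) (Δ c) = c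

/-- A right comodule structure over a `P`-coring `C` on the right `P`-module `M`: a right
`P`-linear, coassociative and counital coaction `M → M ⊗_P C`. -/
structure Coaction {X : Bimod k P P C} (D : Coring X) (act : RightAct k P M) where
  ρ : M →ₗ[k] BTensor act X.left
  ρ_right : ∀ p m, ρ (act (op p) m) = rightOn act X (op p) (ρ m)
  coassoc : ∀ m, assoc act X X.left (map ρ LinearMap.id ρ_right (fun _ _ => rfl) (ρ m))
    = map LinearMap.id D.Δ (fun _ _ => rfl) D.Δ_left (ρ m)
  /-- `m₍₀₎ ε(m₍₁₎) = m` -/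
  counit : ∀ m, lift act X.left (rightEval act D.ε)
    (rightEval_balanced act X D.ε D.ε_left) (ρ m) = m

/-- A `k`-linear map is a morphism of right comodules if it is right `P`-linear and commutes with
the coactions. -/
structure IsComoduleMap {X : Bimod k P P C} {D : Coring X} {a : RightAct k P M}
    {a' : RightAct k P N} (V : Coaction D a) (W : Coaction D a') (f : M →ₗ[k] N) : Prop where
  linear : ∀ p m, f (a (op p) m) = a' (op p) (f m)
  colinear : ∀ m, W.ρ (f m) = map f LinearMap.id linear (fun _ _ => rfl) (V.ρ m)

/-- A coring as a right comodule over itself, via its comultiplication. -/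
def Coring.regular {X : Bimod k P P C} (D : Coring X) : Coaction D X.right where
  ρ := D.Δ
  ρ_right := D.Δ_right
  coassoc := D.coassoc
  counit := D.counit_right

/-- The coaction `B ⊗_Q ρ : B ⊗_Q M → B ⊗_Q (M ⊗_P C) ≃ (B ⊗_Q M) ⊗_P C`, for a left `Q`-linear
map `ρ : M → M ⊗_P C` on a `Q`-`P`-bimodule `M`. -/
def inducedMap {X : Bimod k P P C} (b : RightAct k Q B) (Y : Bimod k Q P M)
    (ρ : M →ₗ[k] BTensor Y.right X.left)
    (hρ : ∀ q m, ρ (Y.left q m) = leftOn Y X.left q (ρ m)) :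
    BTensor b Y.left →ₗ[k] BTensor (rightOn b Y) X.left :=
  (assoc b Y X.left).symm.toLinearMap ∘ₗ map LinearMap.id ρ (fun _ _ => rfl) hρ

theorem inducedMap_tmul {X : Bimod k P P C} (b : RightAct k Q B) (Y : Bimod k Q P M)
    (ρ : M →ₗ[k] BTensor Y.right X.left)
    (hρ : ∀ q m, ρ (Y.left q m) = leftOn Y X.left q (ρ m)) (x : B) (m : M) :
    inducedMap b Y ρ hρ (tmul b Y.left x m)
      = map (a := Y.right) (b := X.left) (a' := rightOn b Y) (b' := X.left) (tmul b Y.left x)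
          LinearMap.id (tmul_right_linear b Y x) (fun _ _ => rfl) (ρ m) := by
  simp [inducedMap, assoc_symm_tmul]

theorem inducedMap_right {X : Bimod k P P C} {D : Coring X} (b : RightAct k Q B)
    (Y : Bimod k Q P M) (V : Coaction D Y.right)
    (hρ : ∀ q m, V.ρ (Y.left q m) = leftOn Y X.left q (V.ρ m)) (p : P) (y : BTensor b Y.left) :
    inducedMap b Y V.ρ hρ (rightOn b Y (op p) y)
      = rightOn (rightOn b Y) X (op p) (inducedMap b Y V.ρ hρ y) := by
  induction y using tensor_induction with
  | zero => simp
  | add u v hu hv => simp only [map_add, hu, hv]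
  | tmul x m =>
    rw [rightOn_tmul, inducedMap_tmul, inducedMap_tmul, V.ρ_right]
    generalize V.ρ m = z
    induction z using tensor_induction with
    | zero => simp
    | add u v hu hv => simp only [map_add, hu, hv]
    | tmul m c => simp

/-- For a `Q`-`P`-bimodule `M` with a left `Q`-linear right `C`-coaction and a right `Q`-module
`B`, the right `C`-comodule `B ⊗_Q M` with coaction `B ⊗_Q ρ`. -/
def Coaction.induced {X : Bimod k P P C} {D : Coring X} (b : RightAct k Q B)
    (Y : Bimod k Q P M) (V : Coaction D Y.right)
    (hρ : ∀ q m, V.ρ (Y.left q m) = leftOn Y X.left q (V.ρ m)) : Coaction D (rightOn b Y) where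
  ρ := inducedMap b Y V.ρ hρ
  ρ_right := inducedMap_right b Y V hρ
  coassoc := by
    intro y
    induction y using tensor_induction with
    | zero => simp
    | add u v hu hv => simp only [map_add, hu, hv]
    | tmul x m =>
      have key : ∀ z : BTensor Y.right X.left,
          assoc (rightOn b Y) X X.left
              (map (inducedMap b Y V.ρ hρ) LinearMap.id (inducedMap_right b Y V hρ)
                (fun _ _ => rfl)
                (map (a := Y.right) (b := X.left) (a' := rightOn b Y) (b' := X.left)
                  (tmul b Y.left x) LinearMap.id (tmul_right_linear b Y x) (fun _ _ => rfl) z))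
            = map (a := Y.right) (b := leftOn X X.left) (a' := rightOn b Y)
                (b' := leftOn X X.left) (tmul b Y.left x) LinearMap.id (tmul_right_linear b Y x)
                (fun _ _ => rfl)
                (assoc Y.right X X.left
                  (map V.ρ LinearMap.id V.ρ_right (fun _ _ => rfl) z)) := by
        intro z
        induction z using tensor_induction with
        | zero => simp
        | add u v hu hv => simp only [map_add, hu, hv]
        | tmul m c =>
          rw [map_tmul, map_tmul, map_tmul, inducedMap_tmul]
          generalize V.ρ m = w
          induction w using tensor_induction with
          | zero => simp
          | add u v hu hv => simp only [map_add, LinearMap.add_apply, hu, hv]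
          | tmul m' c' => simp
      rw [inducedMap_tmul]
      refine (key _).trans ?_
      rw [V.coassoc, map_map, map_map]
      rfl
  counit := by
    intro y
    induction y using tensor_induction with
    | zero => simp
    | add u v hu hv => simp only [map_add, hu, hv]
    | tmul x m =>
      rw [inducedMap_tmul]
      conv_rhs => rw [← V.counit m]
      generalize V.ρ m = z
      induction z using tensor_induction with
      | zero => simp
      | add u v hu hv => simp only [map_add, hu, hv]
      | tmul m c => simp

end Corings


/-! ### Bialgebroids and Hopf algebroids -/

section Hopf

/-- Left multiplication, as a left `H`-module structure on `H`. -/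
abbrev leftMul (k H : Type*) [CommRing k] [Ring H] [Algebra k H] : LeftAct k H H :=
  Algebra.lmul k H

/-- Right multiplication, as a right `H`-module structure on `H`. -/
abbrev rightMul (k H : Type*) [CommRing k] [Ring H] [Algebra k H] : RightAct k H H :=
  Algebra.lsmul k k H

section Mul

variable {k P A C M N : Type*} [CommRing k] [Ring P] [Algebra k P] [Ring A] [Algebra k A]
  [AddCommGroup M] [Module k M] [AddCommGroup N] [Module k N]

/-- The map `M ⊗_P N → A`, `m ⊗ n ↦ f(m) g(n)`. -/
def mulMap (a : RightAct k P M) (b : LeftAct k P N) (f : M →ₗ[k] A) (g : N →ₗ[k] A)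
    (hfg : ∀ m p n, f (a (op p) m) * g n = f m * g (b p n)) : BTensor a b →ₗ[k] A :=
  lift a b ((LinearMap.mul k A).compl₁₂ f g) hfg

@[simp]
theorem mulMap_tmul (a : RightAct k P M) (b : LeftAct k P N) (f : M →ₗ[k] A) (g : N →ₗ[k] A)
    (hfg : ∀ m p n, f (a (op p) m) * g n = f m * g (b p n)) (m : M) (n : N) :
    mulMap a b f g hfg (tmul a b m n) = f m * g n :=
  lift_tmul a b _ hfg m n

end Mul

variable (k L R H : Type*) [CommRing k] [Ring L] [Algebra k L] [Ring R] [Algebra k R]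
  [Ring H] [Algebra k H]

/-- The `L`-bimodule `l h l' = s(l) t(l') h` of a left bialgebroid. -/
def leftBimod {k L H : Type*} [CommRing k] [Ring L] [Algebra k L] [Ring H] [Algebra k H]
    (s : L →ₐ[k] H) (t : Lᵐᵒᵖ →ₐ[k] H) (st : ∀ l l', s l * t l' = t l' * s l) :
    Bimod k L L H where
  left := (leftMul k H).comp s
  right := (leftMul k H).comp t
  comm := fun l l' h => by simp [← mul_assoc, st]

/-- The `R`-bimodule `r h r' = h s(r') t(r)` of a right bialgebroid. -/
def rightBimod {k R H : Type*} [CommRing k] [Ring R] [Algebra k R] [Ring H] [Algebra k H]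
    (s : R →ₐ[k] H) (t : Rᵐᵒᵖ →ₐ[k] H) (st : ∀ r r', s r * t r' = t r' * s r) :
    Bimod k R R H where
  left := (rightMul k H).comp (AlgHom.opComm.symm t)
  right := (rightMul k H).comp (AlgHom.op s)
  comm := fun r r' h => by simp [mul_assoc, st]

@[simp]
theorem leftBimod_left {k L H : Type*} [CommRing k] [Ring L] [Algebra k L] [Ring H] [Algebra k H]
    (s : L →ₐ[k] H) (t : Lᵐᵒᵖ →ₐ[k] H) (st : ∀ l l', s l * t l' = t l' * s l) (l : L) (h : H) :
    (leftBimod s t st).left l h = s l * h := rfl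

@[simp]
theorem leftBimod_right {k L H : Type*} [CommRing k] [Ring L] [Algebra k L] [Ring H] [Algebra k H]
    (s : L →ₐ[k] H) (t : Lᵐᵒᵖ →ₐ[k] H) (st : ∀ l l', s l * t l' = t l' * s l) (l : Lᵐᵒᵖ) (h : H) :
    (leftBimod s t st).right l h = t l * h := rfl

@[simp]
theorem rightBimod_left {k R H : Type*} [CommRing k] [Ring R] [Algebra k R] [Ring H] [Algebra k H]
    (s : R →ₐ[k] H) (t : Rᵐᵒᵖ →ₐ[k] H) (st : ∀ r r', s r * t r' = t r' * s r) (r : R) (h : H) :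
    (rightBimod s t st).left r h = h * t (op r) := rfl

@[simp]
theorem rightBimod_right {k R H : Type*} [CommRing k] [Ring R] [Algebra k R] [Ring H] [Algebra k H]
    (s : R →ₐ[k] H) (t : Rᵐᵒᵖ →ₐ[k] H) (st : ∀ r r', s r * t r' = t r' * s r) (r : Rᵐᵒᵖ) (h : H) :
    (rightBimod s t st).right r h = h * s (unop r) := rfl

theorem leftBimod_right_mul {k L H : Type*} [CommRing k] [Ring L] [Algebra k L] [Ring H] [Algebra k H]
    (s : L →ₐ[k] H) (t : Lᵐᵒᵖ →ₐ[k] H) (st : ∀ l l', s l * t l' = t l' * s l)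
    (x : H) (l : L) (h : H) : LinearMap.mulRight k x ((leftBimod s t st).right (op l) h)
      = (leftBimod s t st).right (op l) (LinearMap.mulRight k x h) := by
  simp [mul_assoc]

theorem leftBimod_left_mul {k L H : Type*} [CommRing k] [Ring L] [Algebra k L] [Ring H] [Algebra k H]
    (s : L →ₐ[k] H) (t : Lᵐᵒᵖ →ₐ[k] H) (st : ∀ l l', s l * t l' = t l' * s l)
    (x : H) (l : L) (h : H) : LinearMap.mulRight k x ((leftBimod s t st).left l h)
      = (leftBimod s t st).left l (LinearMap.mulRight k x h) := by
  simp [mul_assoc]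

theorem rightBimod_mul_right {k R H : Type*} [CommRing k] [Ring R] [Algebra k R] [Ring H] [Algebra k H]
    (s : R →ₐ[k] H) (t : Rᵐᵒᵖ →ₐ[k] H) (st : ∀ r r', s r * t r' = t r' * s r)
    (x : H) (r : R) (h : H) : LinearMap.mulLeft k x ((rightBimod s t st).right (op r) h)
      = (rightBimod s t st).right (op r) (LinearMap.mulLeft k x h) := by
  simp [mul_assoc]

theorem rightBimod_mul_left {k R H : Type*} [CommRing k] [Ring R] [Algebra k R] [Ring H] [Algebra k H]
    (s : R →ₐ[k] H) (t : Rᵐᵒᵖ →ₐ[k] H) (st : ∀ r r', s r * t r' = t r' * s r)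
    (x : H) (r : R) (h : H) : LinearMap.mulLeft k x ((rightBimod s t st).left r h)
      = (rightBimod s t st).left r (LinearMap.mulLeft k x h) := by
  simp [mul_assoc]

/-- A left bialgebroid over `L` with total algebra `H`. -/
structure LeftBialgebroid where
  /-- the source map -/
  s : L →ₐ[k] H
  /-- the target map -/
  t : Lᵐᵒᵖ →ₐ[k] H
  st : ∀ l l', s l * t l' = t l' * s l
  coring : Coring (leftBimod s t st)
  /-- The coproduct has its range in the Takeuchi product:
  `h₍₁₎ t(l) ⊗ h₍₂₎ = h₍₁₎ ⊗ h₍₂₎ s(l)`. -/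
  takeuchi : ∀ (l : L) (h : H),
    map (a' := (leftBimod s t st).right) (b' := (leftBimod s t st).left)
        (LinearMap.mulRight k (t (op l))) LinearMap.id
        (leftBimod_right_mul s t st (t (op l))) (fun _ _ => rfl) (coring.Δ h)
      = map LinearMap.id (LinearMap.mulRight k (s l))
        (fun _ _ => rfl) (leftBimod_left_mul s t st (s l)) (coring.Δ h)
  Δ_one : coring.Δ 1 = tmul _ _ 1 1
  /-- `Δ(h h') = Δ(h) Δ(h')`, where the factorwise product is computed from any representatives
  in `H ⊗ₖ H`. -/
  Δ_mul : ∀ (h h' : H) (u v : H ⊗[k] H), quo _ _ u = coring.Δ h → quo _ _ v = coring.Δ h' →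
    coring.Δ (h * h') = quo _ _ (u * v)
  ε_one : coring.ε 1 = 1
  ε_s : ∀ h h', coring.ε (h * s (coring.ε h')) = coring.ε (h * h')
  ε_t : ∀ h h', coring.ε (h * t (op (coring.ε h'))) = coring.ε (h * h')

/-- A right bialgebroid over `R` with total algebra `H`. -/
structure RightBialgebroid where
  /-- the source map -/
  s : R →ₐ[k] H
  /-- the target map -/
  t : Rᵐᵒᵖ →ₐ[k] H
  st : ∀ r r', s r * t r' = t r' * s r
  coring : Coring (rightBimod s t st)
  /-- The coproduct has its range in the Takeuchi product:
  `s(r) h⁽¹⁾ ⊗ h⁽²⁾ = h⁽¹⁾ ⊗ t(r) h⁽²⁾`. -/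
  takeuchi : ∀ (r : R) (h : H),
    map (a' := (rightBimod s t st).right) (b' := (rightBimod s t st).left)
        (LinearMap.mulLeft k (s r)) LinearMap.id
        (rightBimod_mul_right s t st (s r)) (fun _ _ => rfl) (coring.Δ h)
      = map LinearMap.id (LinearMap.mulLeft k (t (op r)))
        (fun _ _ => rfl) (rightBimod_mul_left s t st (t (op r))) (coring.Δ h)
  Δ_one : coring.Δ 1 = tmul _ _ 1 1
  /-- `Δ(h h') = Δ(h) Δ(h')`, where the factorwise product is computed from any representatives
  in `H ⊗ₖ H`. -/
  Δ_mul : ∀ (h h' : H) (u v : H ⊗[k] H), quo _ _ u = coring.Δ h → quo _ _ v = coring.Δ h' →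
    coring.Δ (h * h') = quo _ _ (u * v)
  ε_one : coring.ε 1 = 1
  ε_s : ∀ h h', coring.ε (s (coring.ε h) * h') = coring.ε (h * h')
  ε_t : ∀ h h', coring.ε (t (op (coring.ε h)) * h') = coring.ε (h * h')

/-- A left `L`-bialgebroid and a right `R`-bialgebroid on the same total algebra `H`, with
compatible source and target maps. -/
structure BialgebroidPair where
  left : LeftBialgebroid k L H
  right : RightBialgebroid k R H
  sL_t : ∀ r, left.s (left.coring.ε (right.t r)) = right.t r
  tL_s : ∀ r, left.t (op (left.coring.ε (right.s r))) = right.s r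
  sR_t : ∀ l, right.s (right.coring.ε (left.t l)) = left.t l
  tR_s : ∀ l, right.t (op (right.coring.ε (left.s l))) = left.s l

namespace BialgebroidPair

variable {k L R H}
variable (D : BialgebroidPair k L R H)

/-- `H` as an `L`-bimodule, `l h l' = s_L(l) t_L(l') h`. -/
abbrev bimodL : Bimod k L L H := leftBimod D.left.s D.left.t D.left.st

/-- `H` as an `R`-bimodule, `r h r' = h s_R(r') t_R(r)`. -/
abbrev bimodR : Bimod k R R H := rightBimod D.right.s D.right.t D.right.st

/-- `H` as an `L`-`R`-bimodule, `l h r = s_L(l) h s_R(r)`. -/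
abbrev bimodLR : Bimod k L R H where
  left := D.bimodL.left
  right := D.bimodR.right
  comm := fun l r h => by simp [mul_assoc]

/-- `H` as an `R`-`L`-bimodule, `r h l = t_L(l) h t_R(r)`. -/
abbrev bimodRL : Bimod k R L H where
  left := D.bimodR.left
  right := D.bimodL.right
  comm := fun r l h => by simp [mul_assoc]

/-- The left coproduct `γ_L : H → H ⊗_L H`. -/
abbrev γL : H →ₗ[k] BTensor D.bimodL.right D.bimodL.left := D.left.coring.Δ

/-- The right coproduct `γ_R : H → H ⊗_R H`. -/
abbrev γR : H →ₗ[k] BTensor D.bimodR.right D.bimodR.left := D.right.coring.Δ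

/-- The left counit `π_L : H → L`. -/
abbrev πL : H →ₗ[k] L := D.left.coring.ε

/-- The right counit `π_R : H → R`. -/
abbrev πR : H →ₗ[k] R := D.right.coring.ε

/-! The source and target axioms make `γ_L` an `R`-bimodule map and `γ_R` an `L`-bimodule map. -/

theorem γL_mul_sR (r : R) (h : H) :
    D.γL (D.bimodR.right (op r) h) = rightOn D.bimodL.right D.bimodLR (op r) (D.γL h) := by
  obtain ⟨u, hu⟩ := quo_surjective _ _ (D.γL h)
  have h1 : quo D.bimodL.right D.bimodL.left (1 ⊗ₜ[k] D.right.s r) = D.γL (D.right.s r) := by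
    have := D.left.coring.Δ_right (D.left.coring.ε (D.right.s r)) 1
    rw [D.left.Δ_one] at this
    simpa [D.tL_s] using this.symm
  have h2 := D.left.Δ_mul h (D.right.s r) u _ hu h1
  have h3 : D.bimodR.right (op r) h = h * D.right.s r := by simp
  rw [h3]
  refine h2.trans ?_
  rw [← hu]
  clear hu h2
  induction u with
  | zero => simp
  | tmul x y => simp
  | add u v hu hv => simp only [add_mul, map_add, hu, hv]

theorem γL_mul_tR (r : R) (h : H) :
    D.γL (D.bimodR.left r h) = leftOn D.bimodRL D.bimodL.left r (D.γL h) := by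
  obtain ⟨u, hu⟩ := quo_surjective _ _ (D.γL h)
  have h1 : quo D.bimodL.right D.bimodL.left (D.right.t (op r) ⊗ₜ[k] 1)
      = D.γL (D.right.t (op r)) := by
    have := D.left.coring.Δ_left (D.left.coring.ε (D.right.t (op r))) 1
    rw [D.left.Δ_one] at this
    simpa [D.sL_t] using this.symm
  have h2 := D.left.Δ_mul h (D.right.t (op r)) u _ hu h1
  have h3 : D.bimodR.left r h = h * D.right.t (op r) := by simp
  rw [h3]
  refine h2.trans ?_
  rw [← hu]
  clear hu h2
  induction u with
  | zero => simp
  | tmul x y => simp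
  | add u v hu hv => simp only [add_mul, map_add, hu, hv]

theorem γR_sL_mul (l : L) (h : H) :
    D.γR (D.bimodL.left l h) = leftOn D.bimodLR D.bimodR.left l (D.γR h) := by
  obtain ⟨u, hu⟩ := quo_surjective _ _ (D.γR h)
  have h1 : quo D.bimodR.right D.bimodR.left (D.left.s l ⊗ₜ[k] 1) = D.γR (D.left.s l) := by
    have := D.right.coring.Δ_left (D.right.coring.ε (D.left.s l)) 1
    rw [D.right.Δ_one] at this
    simpa [D.tR_s] using this.symm
  have h2 := D.right.Δ_mul (D.left.s l) h _ u h1 hu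
  have h3 : D.bimodL.left l h = D.left.s l * h := by simp
  rw [h3]
  refine h2.trans ?_
  rw [← hu]
  clear hu h2
  induction u with
  | zero => simp
  | tmul x y => simp
  | add u v hu hv => simp only [mul_add, map_add, hu, hv]

theorem γR_tL_mul (l : L) (h : H) :
    D.γR (D.bimodL.right (op l) h) = rightOn D.bimodR.right D.bimodRL (op l) (D.γR h) := by
  obtain ⟨u, hu⟩ := quo_surjective _ _ (D.γR h)
  have h1 : quo D.bimodR.right D.bimodR.left (1 ⊗ₜ[k] D.left.t (op l))
      = D.γR (D.left.t (op l)) := by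
    have := D.right.coring.Δ_right (D.right.coring.ε (D.left.t (op l))) 1
    rw [D.right.Δ_one] at this
    simpa [D.sR_t] using this.symm
  have h2 := D.right.Δ_mul (D.left.t (op l)) h _ u h1 hu
  have h3 : D.bimodL.right (op l) h = D.left.t (op l) * h := by simp
  rw [h3]
  refine h2.trans ?_
  rw [← hu]
  clear hu h2
  induction u with
  | zero => simp
  | tmul x y => simp
  | add u v hu hv => simp only [mul_add, map_add, hu, hv]

theorem antipode_balanced_left (S : H →ₗ[k] H)
    (hS : ∀ l r h, S (D.left.t (op l) * h * D.right.t (op r)) = D.right.s r * S h * D.left.s l)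
    (x : H) (l : L) (y : H) :
    S (D.bimodL.right (op l) x) * LinearMap.id (R := k) y
      = S x * LinearMap.id (R := k) (D.bimodL.left l y) := by
  simpa [mul_assoc] using congrArg (· * y) (hS l 1 x)

theorem antipode_balanced_right (S : H →ₗ[k] H)
    (hS : ∀ l r h, S (D.left.t (op l) * h * D.right.t (op r)) = D.right.s r * S h * D.left.s l)
    (x : H) (r : R) (y : H) :
    LinearMap.id (R := k) (D.bimodR.right (op r) x) * S y
      = LinearMap.id (R := k) x * S (D.bimodR.left r y) := by
  simpa [mul_assoc] using (congrArg (x * ·) (hS 1 r y)).symm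

end BialgebroidPair

/-- A Hopf algebroid: a left `L`-bialgebroid and a right `R`-bialgebroid on the same total algebra
`H`, with compatible source and target maps and mixed coassociative coproducts, and an antipode. -/
structure HopfAlgebroid extends BialgebroidPair k L R H where
  /-- `(γ_L ⊗_R H) ∘ γ_R = (H ⊗_L γ_R) ∘ γ_L` -/
  colinLR : ∀ h, assoc toBialgebroidPair.bimodL.right toBialgebroidPair.bimodLR
      toBialgebroidPair.bimodR.left
      (map toBialgebroidPair.γL LinearMap.id toBialgebroidPair.γL_mul_sR (fun _ _ => rfl)
        (toBialgebroidPair.γR h))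
    = map LinearMap.id toBialgebroidPair.γR (fun _ _ => rfl) toBialgebroidPair.γR_sL_mul
        (toBialgebroidPair.γL h)
  /-- `(γ_R ⊗_L H) ∘ γ_L = (H ⊗_R γ_L) ∘ γ_R` -/
  colinRL : ∀ h, assoc toBialgebroidPair.bimodR.right toBialgebroidPair.bimodRL
      toBialgebroidPair.bimodL.left
      (map toBialgebroidPair.γR LinearMap.id toBialgebroidPair.γR_tL_mul (fun _ _ => rfl)
        (toBialgebroidPair.γL h))
    = map LinearMap.id toBialgebroidPair.γL (fun _ _ => rfl) toBialgebroidPair.γL_mul_tR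
        (toBialgebroidPair.γR h)
  /-- the antipode -/
  S : H →ₗ[k] H
  S_tL_tR : ∀ l r h, S (left.t (op l) * h * right.t (op r)) = right.s r * S h * left.s l
  S_tR_tL : ∀ l r h, S (right.t (op r) * h * left.t (op l)) = left.s l * S h * right.s r
  /-- `S(h₍₁₎) h₍₂₎ = s_R(π_R(h))` -/
  S_left : ∀ h, mulMap toBialgebroidPair.bimodL.right toBialgebroidPair.bimodL.left
      S LinearMap.id
      (toBialgebroidPair.antipode_balanced_left S S_tL_tR)
      (toBialgebroidPair.γL h)
    = right.s (toBialgebroidPair.πR h)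
  /-- `h⁽¹⁾ S(h⁽²⁾) = s_L(π_L(h))` -/
  S_right : ∀ h, mulMap toBialgebroidPair.bimodR.right toBialgebroidPair.bimodR.left
      LinearMap.id S
      (toBialgebroidPair.antipode_balanced_right S S_tL_tR)
      (toBialgebroidPair.γR h)
    = left.s (toBialgebroidPair.πL h)

variable {k L R H}

/-! ### Comodules of Hopf algebroids -/

section Comodules

variable {M N : Type*} [AddCommGroup M] [Module k M] [AddCommGroup N] [Module k N]

/-- A right comodule of a Hopf algebroid: a right `R`-module and right `L`-module `M` with a
coaction `ρ_R` of the right bialgebroid and a coaction `ρ_L` of the left bialgebroid, each being a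
comodule map with respect to the other bialgebroid. -/
structure RightComodule (𝓗 : HopfAlgebroid k L R H) (M : Type*) [AddCommGroup M] [Module k M] where
  actR : RightAct k R M
  actL : RightAct k L M
  coR : Coaction 𝓗.right.coring actR
  coL : Coaction 𝓗.left.coring actL
  /-- `ρ_R` is right `L`-linear. -/
  coR_linear : ∀ l m, coR.ρ (actL (op l) m) = rightOn actR 𝓗.bimodRL (op l) (coR.ρ m)
  /-- `ρ_L` is right `R`-linear. -/
  coL_linear : ∀ r m, coL.ρ (actR (op r) m) = rightOn actL 𝓗.bimodLR (op r) (coL.ρ m)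
  /-- `(ρ_R ⊗_L H) ∘ ρ_L = (M ⊗_R γ_L) ∘ ρ_R` -/
  compat_RL : ∀ m, assoc actR 𝓗.bimodRL 𝓗.bimodL.left
      (map coR.ρ LinearMap.id coR_linear (fun _ _ => rfl) (coL.ρ m))
    = map LinearMap.id 𝓗.γL (fun _ _ => rfl) 𝓗.γL_mul_tR (coR.ρ m)
  /-- `(ρ_L ⊗_R H) ∘ ρ_R = (M ⊗_L γ_R) ∘ ρ_L` -/
  compat_LR : ∀ m, assoc actL 𝓗.bimodLR 𝓗.bimodR.left
      (map coL.ρ LinearMap.id coL_linear (fun _ _ => rfl) (coR.ρ m))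
    = map LinearMap.id 𝓗.γR (fun _ _ => rfl) 𝓗.γR_sL_mul (coL.ρ m)

variable {𝓗 : HopfAlgebroid k L R H}

/-- A right `𝓗`-colinear map: a comodule map for both constituent bialgebroids. -/
structure IsColinear (V : RightComodule 𝓗 M) (W : RightComodule 𝓗 N) (f : M →ₗ[k] N) : Prop where
  right : IsComoduleMap V.coR W.coR f
  left : IsComoduleMap V.coL W.coL f

/-- The total algebra `H` as a right comodule, via the two coproducts. -/
def regularComodule (𝓗 : HopfAlgebroid k L R H) : RightComodule 𝓗 H where
  actR := 𝓗.bimodR.right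
  actL := 𝓗.bimodL.right
  coR := 𝓗.right.coring.regular
  coL := 𝓗.left.coring.regular
  coR_linear := 𝓗.γR_tL_mul
  coL_linear := 𝓗.γL_mul_sR
  compat_RL := 𝓗.colinRL
  compat_LR := 𝓗.colinLR

theorem induced_coR_linear (𝓗 : HopfAlgebroid k L R H) {B : Type*} [AddCommGroup B] [Module k B]
    (b : RightAct k L B) (l : L) (y : BTensor b 𝓗.bimodL.left) :
    inducedMap b 𝓗.bimodLR 𝓗.γR 𝓗.γR_sL_mul (rightOn b 𝓗.bimodL (op l) y)
      = rightOn (rightOn b 𝓗.bimodLR) 𝓗.bimodRL (op l) (inducedMap b 𝓗.bimodLR 𝓗.γR 𝓗.γR_sL_mul y) := by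
  induction y using tensor_induction with
  | zero => simp
  | add u v hu hv => simp only [map_add, hu, hv]
  | tmul x h =>
    rw [rightOn_tmul, inducedMap_tmul, inducedMap_tmul, 𝓗.γR_tL_mul]
    generalize 𝓗.γR h = z
    induction z using tensor_induction with
    | zero => simp
    | add u v hu hv => simp only [map_add, hu, hv]
    | tmul m c => simp

theorem induced_coL_linear (𝓗 : HopfAlgebroid k L R H) {B : Type*} [AddCommGroup B] [Module k B]
    (b : RightAct k L B) (r : R) (y : BTensor b 𝓗.bimodL.left) :
    inducedMap b 𝓗.bimodL 𝓗.γL 𝓗.left.coring.Δ_left (rightOn b 𝓗.bimodLR (op r) y)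
      = rightOn (rightOn b 𝓗.bimodL) 𝓗.bimodLR (op r) (inducedMap b 𝓗.bimodL 𝓗.γL 𝓗.left.coring.Δ_left y) := by
  induction y using tensor_induction with
  | zero => simp
  | add u v hu hv => simp only [map_add, hu, hv]
  | tmul x h =>
    rw [rightOn_tmul, inducedMap_tmul, inducedMap_tmul, 𝓗.γL_mul_sR]
    generalize 𝓗.γL h = z
    induction z using tensor_induction with
    | zero => simp
    | add u v hu hv => simp only [map_add, hu, hv]
    | tmul m c => simp

theorem induced_compat_RL (𝓗 : HopfAlgebroid k L R H) {B : Type*} [AddCommGroup B] [Module k B]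
    (b : RightAct k L B) (y : BTensor b 𝓗.bimodL.left) :
    assoc (rightOn b 𝓗.bimodLR) 𝓗.bimodRL 𝓗.bimodL.left
        (map (inducedMap b 𝓗.bimodLR 𝓗.γR 𝓗.γR_sL_mul) LinearMap.id (induced_coR_linear 𝓗 b)
          (fun _ _ => rfl) (inducedMap b 𝓗.bimodL 𝓗.γL 𝓗.left.coring.Δ_left y))
      = map LinearMap.id 𝓗.γL (fun _ _ => rfl) 𝓗.γL_mul_tR
          (inducedMap b 𝓗.bimodLR 𝓗.γR 𝓗.γR_sL_mul y) := by
  induction y using tensor_induction with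
  | zero => simp
  | add u v hu hv => simp only [map_add, hu, hv]
  | tmul x h =>
    have key : ∀ z : BTensor 𝓗.bimodL.right 𝓗.bimodL.left,
        assoc (rightOn b 𝓗.bimodLR) 𝓗.bimodRL 𝓗.bimodL.left
            (map (inducedMap b 𝓗.bimodLR 𝓗.γR 𝓗.γR_sL_mul) LinearMap.id (induced_coR_linear 𝓗 b)
              (fun _ _ => rfl)
              (map (a := 𝓗.bimodL.right) (b := 𝓗.bimodL.left) (a' := rightOn b 𝓗.bimodL)
                (b' := 𝓗.bimodL.left) (tmul b 𝓗.bimodL.left x) LinearMap.id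
                (tmul_right_linear b 𝓗.bimodL x) (fun _ _ => rfl) z))
          = map (a := 𝓗.bimodLR.right) (b := leftOn 𝓗.bimodRL 𝓗.bimodL.left)
              (a' := rightOn b 𝓗.bimodLR) (b' := leftOn 𝓗.bimodRL 𝓗.bimodL.left)
              (tmul b 𝓗.bimodL.left x) LinearMap.id (tmul_right_linear b 𝓗.bimodLR x) (fun _ _ => rfl)
              (assoc 𝓗.bimodLR.right 𝓗.bimodRL 𝓗.bimodL.left
                (map 𝓗.γR LinearMap.id 𝓗.γR_tL_mul (fun _ _ => rfl) z)) := by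
      intro z
      induction z using tensor_induction with
      | zero => simp
      | add u v hu hv => simp only [map_add, hu, hv]
      | tmul m c =>
        rw [map_tmul, map_tmul, map_tmul, inducedMap_tmul]
        generalize 𝓗.γR m = w
        induction w using tensor_induction with
        | zero => simp
        | add u v hu hv => simp only [map_add, LinearMap.add_apply, hu, hv]
        | tmul m' c' => simp
    rw [inducedMap_tmul, inducedMap_tmul]
    refine (key _).trans ?_
    rw [𝓗.colinRL, map_map, map_map]
    rfl

theorem induced_compat_LR (𝓗 : HopfAlgebroid k L R H) {B : Type*} [AddCommGroup B] [Module k B]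
    (b : RightAct k L B) (y : BTensor b 𝓗.bimodL.left) :
    assoc (rightOn b 𝓗.bimodL) 𝓗.bimodLR 𝓗.bimodR.left
        (map (inducedMap b 𝓗.bimodL 𝓗.γL 𝓗.left.coring.Δ_left) LinearMap.id (induced_coL_linear 𝓗 b)
          (fun _ _ => rfl) (inducedMap b 𝓗.bimodLR 𝓗.γR 𝓗.γR_sL_mul y))
      = map LinearMap.id 𝓗.γR (fun _ _ => rfl) 𝓗.γR_sL_mul
          (inducedMap b 𝓗.bimodL 𝓗.γL 𝓗.left.coring.Δ_left y) := by
  induction y using tensor_induction with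
  | zero => simp
  | add u v hu hv => simp only [map_add, hu, hv]
  | tmul x h =>
    have key : ∀ z : BTensor 𝓗.bimodLR.right 𝓗.bimodR.left,
        assoc (rightOn b 𝓗.bimodL) 𝓗.bimodLR 𝓗.bimodR.left
            (map (inducedMap b 𝓗.bimodL 𝓗.γL 𝓗.left.coring.Δ_left) LinearMap.id (induced_coL_linear 𝓗 b)
              (fun _ _ => rfl)
              (map (a := 𝓗.bimodLR.right) (b := 𝓗.bimodR.left) (a' := rightOn b 𝓗.bimodLR)
                (b' := 𝓗.bimodR.left) (tmul b 𝓗.bimodL.left x) LinearMap.id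
                (tmul_right_linear b 𝓗.bimodLR x) (fun _ _ => rfl) z))
          = map (a := 𝓗.bimodL.right) (b := leftOn 𝓗.bimodLR 𝓗.bimodR.left)
              (a' := rightOn b 𝓗.bimodL) (b' := leftOn 𝓗.bimodLR 𝓗.bimodR.left)
              (tmul b 𝓗.bimodL.left x) LinearMap.id (tmul_right_linear b 𝓗.bimodL x) (fun _ _ => rfl)
              (assoc 𝓗.bimodL.right 𝓗.bimodLR 𝓗.bimodR.left
                (map 𝓗.γL LinearMap.id 𝓗.γL_mul_sR (fun _ _ => rfl) z)) := by
      intro z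
      induction z using tensor_induction with
      | zero => simp
      | add u v hu hv => simp only [map_add, hu, hv]
      | tmul m c =>
        rw [map_tmul, map_tmul, map_tmul, inducedMap_tmul]
        generalize 𝓗.γL m = w
        induction w using tensor_induction with
        | zero => simp
        | add u v hu hv => simp only [map_add, LinearMap.add_apply, hu, hv]
        | tmul m' c' => simp
    rw [inducedMap_tmul, inducedMap_tmul]
    refine (key _).trans ?_
    rw [𝓗.colinLR, map_map, map_map]
    rfl

/-- The right `𝓗`-comodule `B ⊗_L H` for a right `L`-module `B`, with coactions `B ⊗_L γ_R` and
`B ⊗_L γ_L`. -/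
def tensorComodule (𝓗 : HopfAlgebroid k L R H) {B : Type*} [AddCommGroup B] [Module k B]
    (b : RightAct k L B) : RightComodule 𝓗 (BTensor b 𝓗.bimodL.left) where
  actR := rightOn b 𝓗.bimodLR
  actL := rightOn b 𝓗.bimodL
  coR := Coaction.induced b 𝓗.bimodLR 𝓗.right.coring.regular 𝓗.γR_sL_mul
  coL := Coaction.induced b 𝓗.bimodL 𝓗.left.coring.regular 𝓗.left.coring.Δ_left
  coR_linear := induced_coR_linear 𝓗 b
  coL_linear := induced_coL_linear 𝓗 b
  compat_RL := induced_compat_RL 𝓗 b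
  compat_LR := induced_compat_LR 𝓗 b

end Comodules

/-! ### Comodule algebras, Galois extensions and cleft extensions -/

section Cleft

theorem mul_right_linear {A : Type*} [Ring A] [Algebra k A] (η : R →ₐ[k] A) (a : RightAct k R A)
    (ha : ∀ r x, a (op r) x = x * η r) (y : A) (r : R) (x : A) :
    LinearMap.mulLeft k y (a (op r) x) = a (op r) (LinearMap.mulLeft k y x) := by
  simp [ha, mul_assoc]

/-- A right `𝓗`-comodule algebra: an `R`-ring `A` with a right `𝓗`-comodule structure, whose right
`R`-module structure is that of the `R`-ring, such that both coactions are unital and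
multiplicative. -/
structure ComoduleAlgebra (𝓗 : HopfAlgebroid k L R H) (A : Type*) [Ring A] [Algebra k A]
    extends RightComodule 𝓗 A where
  /-- the unit map of the `R`-ring `A` -/
  ηR : R →ₐ[k] A
  actR_eq : ∀ r a, actR (op r) a = a * ηR r
  /-- The coaction `ρ_R` has its range in the Takeuchi product `A ×_R H`:
  `η_R(r) a⁽⁰⁾ ⊗ a⁽¹⁾ = a⁽⁰⁾ ⊗ t_R(r) a⁽¹⁾`. -/
  takeuchi : ∀ (r : R) (a : A),
    map (a' := actR) (b' := 𝓗.bimodR.left) (LinearMap.mulLeft k (ηR r)) LinearMap.id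
        (mul_right_linear ηR actR actR_eq (ηR r)) (fun _ _ => rfl) (coR.ρ a)
      = map LinearMap.id (LinearMap.mulLeft k (𝓗.right.t (op r))) (fun _ _ => rfl)
        (rightBimod_mul_left _ _ _ (𝓗.right.t (op r))) (coR.ρ a)
  coR_one : coR.ρ 1 = tmul _ _ 1 1
  /-- `ρ_R(a a') = ρ_R(a) ρ_R(a')`, where the factorwise product is computed from any
  representatives in `A ⊗ₖ H`. -/
  coR_mul : ∀ (a a' : A) (u v : A ⊗[k] H), quo _ _ u = coR.ρ a → quo _ _ v = coR.ρ a' →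
    coR.ρ (a * a') = quo _ _ (u * v)
  coL_one : coL.ρ 1 = tmul _ _ 1 1
  /-- `ρ_L(a a') = ρ_L(a) ρ_L(a')`, where the factorwise product is computed from any
  representatives in `A ⊗ₖ H`. -/
  coL_mul : ∀ (a a' : A) (u v : A ⊗[k] H), quo _ _ u = coL.ρ a → quo _ _ v = coL.ρ a' →
    coL.ρ (a * a') = quo _ _ (u * v)

namespace ComoduleAlgebra

variable {𝓗 : HopfAlgebroid k L R H} {A : Type*} [Ring A] [Algebra k A]
variable (𝓐 : ComoduleAlgebra 𝓗 A)

/-- The subalgebra `B = {b ∈ A | ρ_R(b) = b ⊗ 1}` of coinvariants of the right bialgebroid. -/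
def coinvariants : Subalgebra k A where
  carrier := {b | 𝓐.coR.ρ b = tmul _ _ b 1}
  mul_mem' := by
    intro b b' hb hb'
    have := 𝓐.coR_mul b b' (b ⊗ₜ 1) (b' ⊗ₜ 1) hb.symm hb'.symm
    simpa using this
  add_mem' := by
    intro b b' hb hb'
    simp only [Set.mem_ofPred_eq] at hb hb' ⊢
    simp [hb, hb']
  algebraMap_mem' := by
    intro c
    simp [Algebra.algebraMap_eq_smul_one, 𝓐.coR_one]

theorem mul_actR (y : A) (r : Rᵐᵒᵖ) (x : A) :
    leftMul k A y (𝓐.actR r x) = 𝓐.actR r (leftMul k A y x) := by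
  simpa using mul_right_linear 𝓐.ηR 𝓐.actR 𝓐.actR_eq y (unop r) x

/-- The left `A`-module `A ⊗_R H`, by multiplication on the first factor. -/
def leftA : LeftAct k A (BTensor 𝓐.actR 𝓗.bimodR.left) :=
  actFst 𝓐.actR 𝓗.bimodR.left (leftMul k A) 𝓐.mul_actR

@[simp]
theorem leftA_tmul (y x : A) (h : H) :
    𝓐.leftA y (tmul 𝓐.actR 𝓗.bimodR.left x h) = tmul 𝓐.actR 𝓗.bimodR.left (y * x) h := by
  simp [leftA]

theorem coR_coinvariant_mul (b : 𝓐.coinvariants) (a : A) :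
    𝓐.coR.ρ (b * a) = 𝓐.leftA b (𝓐.coR.ρ a) := by
  obtain ⟨v, hv⟩ := quo_surjective _ _ (𝓐.coR.ρ a)
  rw [𝓐.coR_mul b a ((b : A) ⊗ₜ 1) v b.2.symm hv, ← hv]
  clear hv
  induction v with
  | zero => simp
  | tmul x y => simp
  | add u v hu hv => simp only [mul_add, map_add, hu, hv]

/-- `A` as a right `B`-module. -/
def rightB : RightAct k 𝓐.coinvariants A := (rightMul k A).comp (AlgHom.op 𝓐.coinvariants.val)

/-- `A` as a left `B`-module. -/
def leftB : LeftAct k 𝓐.coinvariants A := (leftMul k A).comp 𝓐.coinvariants.val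

theorem can_balanced (a : A) (b : 𝓐.coinvariants) (a' : A) :
    𝓐.leftA.toLinearMap.compl₂ 𝓐.coR.ρ (𝓐.rightB (op b) a) a'
      = 𝓐.leftA.toLinearMap.compl₂ 𝓐.coR.ρ a (𝓐.leftB b a') := by
  simp [rightB, leftB, coR_coinvariant_mul]

/-- The canonical map `A ⊗_B A → A ⊗_R H`, `a ⊗ a' ↦ a a'⁽⁰⁾ ⊗ a'⁽¹⁾`. -/
def can : BTensor 𝓐.rightB 𝓐.leftB →ₗ[k] BTensor 𝓐.actR 𝓗.bimodR.left :=
  lift 𝓐.rightB 𝓐.leftB (𝓐.leftA.toLinearMap.compl₂ 𝓐.coR.ρ) 𝓐.can_balanced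

/-- The extension `B ⊆ A` is Galois with respect to the right bialgebroid. -/
def IsGalois : Prop := Function.Bijective 𝓐.can

/-! An `L`-ring structure on `A` with `B` an `L`-subring is an algebra map `ηL : L → B`. -/

/-- `B` as a right `L`-module, via the unit map `ηL` of the `L`-ring `B`. -/
def rightL (ηL : L →ₐ[k] 𝓐.coinvariants) : RightAct k L 𝓐.coinvariants :=
  (rightMul k 𝓐.coinvariants).comp (AlgHom.op ηL)

theorem mul_rightL (ηL : L →ₐ[k] 𝓐.coinvariants) (b : 𝓐.coinvariants) (l : Lᵐᵒᵖ)
    (x : 𝓐.coinvariants) : leftMul k 𝓐.coinvariants b (𝓐.rightL ηL l x)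
      = 𝓐.rightL ηL l (leftMul k 𝓐.coinvariants b x) := by
  simp [rightL, mul_assoc]

/-- The `k`-module `B ⊗_L H`. -/
abbrev NormalBasisModule (ηL : L →ₐ[k] 𝓐.coinvariants) : Type _ :=
  BTensor (𝓐.rightL ηL) 𝓗.bimodL.left

/-- The left `B`-module `B ⊗_L H`, by multiplication on the first factor. -/
def normalBasisLeft (ηL : L →ₐ[k] 𝓐.coinvariants) :
    LeftAct k 𝓐.coinvariants (𝓐.NormalBasisModule ηL) :=
  actFst (𝓐.rightL ηL) 𝓗.bimodL.left (leftMul k 𝓐.coinvariants) (𝓐.mul_rightL ηL)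

/-- The normal basis property: `A ≃ B ⊗_L H` as left `B`-modules and right `𝓗`-comodules. -/
def HasNormalBasis (ηL : L →ₐ[k] 𝓐.coinvariants) : Prop :=
  ∃ κ : A ≃ₗ[k] 𝓐.NormalBasisModule ηL,
    (∀ (b : 𝓐.coinvariants) (a : A), κ (b * a) = 𝓐.normalBasisLeft ηL b (κ a)) ∧
    IsColinear 𝓐.toRightComodule (tensorComodule 𝓗 (𝓐.rightL ηL)) κ.toLinearMap

/-- `L`-`R`-bimodule maps `H → A`. -/
def IsBimoduleMapLR (ηL : L →ₐ[k] 𝓐.coinvariants) (j : H →ₗ[k] A) : Prop :=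
  ∀ l r h, j (𝓗.left.s l * h * 𝓗.right.s r) = ηL l * j h * 𝓐.ηR r

/-- `R`-`L`-bimodule maps `H → A`. -/
def IsBimoduleMapRL (ηL : L →ₐ[k] 𝓐.coinvariants) (j' : H →ₗ[k] A) : Prop :=
  ∀ l r h, j' (𝓗.left.t (op l) * h * 𝓗.right.t (op r)) = 𝓐.ηR r * j' h * ηL l

variable {𝓐}

theorem conv_balanced_R {ηL : L →ₐ[k] 𝓐.coinvariants} {j j' : H →ₗ[k] A}
    (hj : 𝓐.IsBimoduleMapLR ηL j) (hj' : 𝓐.IsBimoduleMapRL ηL j') (x : H) (r : R) (y : H) :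
    j (𝓗.bimodR.right (op r) x) * j' y = j x * j' (𝓗.bimodR.left r y) := by
  have h1 := hj 1 r x
  have h2 := hj' 1 r y
  simp only [map_one, one_mul, mul_one, op_one, OneMemClass.coe_one] at h1 h2
  simp [h1, h2, mul_assoc]

theorem conv_balanced_L {ηL : L →ₐ[k] 𝓐.coinvariants} {j j' : H →ₗ[k] A}
    (hj : 𝓐.IsBimoduleMapLR ηL j) (hj' : 𝓐.IsBimoduleMapRL ηL j') (x : H) (l : L) (y : H) :
    j' (𝓗.bimodL.right (op l) x) * j y = j' x * j (𝓗.bimodL.left l y) := by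
  have h1 := hj l 1 y
  have h2 := hj' l 1 x
  simp only [map_one, one_mul, mul_one, op_one] at h1 h2
  simp [h1, h2, mul_assoc]

variable (𝓐)

/-- The `R`-`L`-bimodule map `j'` is the convolution inverse of the `L`-`R`-bimodule map `j`:
`j(h⁽¹⁾) j'(h⁽²⁾) = η_L(π_L(h))` and `j'(h₍₁₎) j(h₍₂₎) = η_R(π_R(h))`. -/
structure IsConvolutionInverse (ηL : L →ₐ[k] 𝓐.coinvariants) (j j' : H →ₗ[k] A) : Prop where
  bimod : 𝓐.IsBimoduleMapLR ηL j
  bimod' : 𝓐.IsBimoduleMapRL ηL j'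
  right_inv : ∀ h, mulMap 𝓗.bimodR.right 𝓗.bimodR.left j j' (conv_balanced_R bimod bimod')
    (𝓗.γR h) = ηL (𝓗.πL h)
  left_inv : ∀ h, mulMap 𝓗.bimodL.right 𝓗.bimodL.left j' j (conv_balanced_L bimod bimod')
    (𝓗.γL h) = 𝓐.ηR (𝓗.πR h)

/-- A cleaving map: a convolution invertible left `L`-linear right `𝓗`-colinear map `H → A`. -/
structure IsCleavingMap (ηL : L →ₐ[k] 𝓐.coinvariants) (j : H →ₗ[k] A) : Prop where
  left_linear : ∀ l h, j (𝓗.left.s l * h) = ηL l * j h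
  colinear : IsColinear (regularComodule 𝓗) 𝓐.toRightComodule j
  invertible : ∃ j' : H →ₗ[k] A, 𝓐.IsConvolutionInverse ηL j j'

/-- The extension `B ⊆ A`, with the `L`-ring structure `ηL`, is `𝓗`-cleft. -/
def IsCleftVia (ηL : L →ₐ[k] 𝓐.coinvariants) : Prop :=
  ∃ j : H →ₗ[k] A, 𝓐.IsCleavingMap ηL j

/-- The extension `B ⊆ A` is `𝓗`-cleft: `A` is an `L`-ring with `B` an `L`-subring, and there is
a cleaving map `H → A`. -/
def IsCleft : Prop :=
  ∃ ηL : L →ₐ[k] 𝓐.coinvariants, 𝓐.IsCleftVia ηL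

end ComoduleAlgebra

end Cleft

end Hopf

end HopfCleft

end

noncomputable section
namespace HopfCleft

/-! Write ρ_R(a) = a⁽⁰⁾ ⊗ a⁽¹⁾ and ρ_L(a) = a₍₀₎ ⊗ a₍₁₎. Both directions turn on the map a♯ = a⁽⁰⁾
j'(a⁽¹⁾) (`sharp`), defined for j' : H → A with j'(h t_R(r)) = η_R(r) j'(h). Mixed coassociativity
gives a₍₀₎♯ j(a₍₁₎) = a⁽⁰⁾ (j' * j)(a⁽¹⁾) (`sharp_mul_coL`), so j' * j = η_R π_R implies a₍₀₎♯
j(a₍₁₎) = a.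

Let j be a cleaving map with convolution inverse j'. The main point is that every a♯ is coinvariant
(`sharp_mem`); the proof never computes ρ_R on the values of j' alone, only on the products j(h⁽¹⁾)
j'(h⁽²⁾) = η_L π_L(h), which lie in B. Hence b ⊗ h ↦ b j(h) and a ↦ a₍₀₎♯ ⊗ a₍₁₎ are mutually
inverse, which is the normal basis property. The canonical map has the inverse a ⊗ h ↦ a j'(h₍₁₎) ⊗
j(h₍₂₎), because a₍₀₎♯ ⊗ j(a₍₁₎) = 1 ⊗ a₍₀₎♯ j(a₍₁₎) = 1 ⊗ a over B.

Conversely, let κ : A ≃ B ⊗_L H be given; put j(h) = κ⁻¹(1 ⊗ h) and p = (B ⊗ π_L) κ : A → B. For a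
Galois extension, left A-linear maps A ⊗_R H → A correspond, by composition with ρ_R, to left
B-linear maps A → A. The map belonging to p has the form a ⊗ h ↦ a j'(h), so a♯ = p(a) and j * j' =
p ∘ j = η_L π_L. Further, a ⊗ h ↦ a (j' * j)(h) and a ⊗ h ↦ a η_R(π_R(h)) both restrict to the
identity along ρ_R, so they agree (`cleavingInv_isConvolutionInverse`).

The antipode enters only through `coL_coinvariant`: ρ_R-coinvariants are ρ_L-coinvariants, whence
ρ_L is left B-linear. Only S(1) = 1 and h⁽¹⁾ S(h⁽²⁾) = s_L π_L(h) and the behaviour of S on t_R are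
needed there, not bijectivity. -/

/-- The inverse of a bijective morphism of comodules is a morphism of comodules. -/
theorem IsComoduleMap.symm {k P C M N : Type*} [CommRing k] [Ring P] [Algebra k P]
    [AddCommGroup C] [Module k C] [AddCommGroup M] [Module k M] [AddCommGroup N] [Module k N]
    {X : Bimod k P P C}
    {D : Coring X} {a : RightAct k P M} {a' : RightAct k P N} {V : Coaction D a}
    {W : Coaction D a'} {e : M ≃ₗ[k] N} (he : IsComoduleMap V W e.toLinearMap) :
    IsComoduleMap W V e.symm.toLinearMap := by
  have lin : ∀ p n, e.symm.toLinearMap (a' (op p) n) = a (op p) (e.symm.toLinearMap n) := by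
    intro p n
    apply e.injective
    have := he.linear p (e.symm n)
    simp only [LinearEquiv.coe_coe, LinearEquiv.apply_symm_apply] at this ⊢
    rw [this]
  refine ⟨lin, fun n => ?_⟩
  have h := he.colinear (e.symm n)
  simp only [LinearEquiv.coe_coe, LinearEquiv.apply_symm_apply] at h
  rw [h]
  generalize V.ρ _ = z
  change z = _
  induction z using tensor_induction with
  | zero => simp
  | tmul m c => simp
  | add u v hu hv => simp only [map_add, ← hu, ← hv]

namespace ComoduleAlgebra

variable {k L R H A : Type*} [CommRing k] [Ring L] [Algebra k L] [Ring R] [Algebra k R]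
  [Ring H] [Algebra k H] [Ring A] [Algebra k A]
variable {𝓗 : HopfAlgebroid k L R H} (𝓐 : ComoduleAlgebra 𝓗 A)

/-! ### The right `A`-module `A ⊗_R H` -/

theorem tmul_mul_ηR (x : A) (r : R) (h : H) :
    tmul 𝓐.actR 𝓗.bimodR.left (x * 𝓐.ηR r) h
      = tmul 𝓐.actR 𝓗.bimodR.left x (h * 𝓗.right.t (op r)) := by
  rw [← 𝓐.actR_eq, tmul_balanced, rightBimod_left]

/-- The map `(x, h) ↦ (x ⊗ h) ρ_R(y)`. -/
def rmulAux (y : A) : A →ₗ[k] H →ₗ[k] BTensor 𝓐.actR 𝓗.bimodR.left :=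
  LinearMap.mk₂ k (fun x h => map (LinearMap.mulLeft k x) (LinearMap.mulLeft k h)
      (fun r z => mul_right_linear 𝓐.ηR 𝓐.actR 𝓐.actR_eq x r z)
      (rightBimod_mul_left 𝓗.right.s 𝓗.right.t 𝓗.right.st h) (𝓐.coR.ρ y))
    (by
      intro x x' h
      rw [← LinearMap.add_apply]
      exact tensor_ext_apply _ _ (fun m n => by simp [add_mul]) _)
    (by
      intro c x h
      rw [← LinearMap.smul_apply]
      exact tensor_ext_apply _ _ (fun m n => by simp) _)
    (by
      intro x h h'
      rw [← LinearMap.add_apply]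
      exact tensor_ext_apply _ _ (fun m n => by simp [add_mul]) _)
    (by
      intro c x h
      rw [← LinearMap.smul_apply]
      exact tensor_ext_apply _ _ (fun m n => by simp) _)

/-- The right action of `A` on `A ⊗_R H`, `(x ⊗ h) y = x y⁽⁰⁾ ⊗ h y⁽¹⁾`. -/
def rmul (y : A) : BTensor 𝓐.actR 𝓗.bimodR.left →ₗ[k] BTensor 𝓐.actR 𝓗.bimodR.left :=
  lift _ _ (𝓐.rmulAux y) (by
    intro x r h
    -- Balancedness over R is the Takeuchi condition for ρ_R(y), multiplied on the left by x ⊗ h.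
    have h1 := congrArg (map (a' := 𝓐.actR) (b' := 𝓗.bimodR.left) (LinearMap.mulLeft k x)
      (LinearMap.mulLeft k h) (fun r z => mul_right_linear 𝓐.ηR 𝓐.actR 𝓐.actR_eq x r z)
      (rightBimod_mul_left 𝓗.right.s 𝓗.right.t 𝓗.right.st h)) (𝓐.takeuchi r y)
    rw [map_map, map_map] at h1
    simp only [rmulAux, LinearMap.mk₂_apply]
    refine Eq.trans ?_ (h1.trans ?_)
    · exact tensor_ext_apply _ _ (fun m n => by simp [𝓐.actR_eq]) _
    · exact tensor_ext_apply _ _ (fun m n => by simp) _)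

/-- Multiplicativity of ρ_R recast as right A-linearity, so that products under ρ_R can be handled
without choosing representatives. -/
theorem rmul_coR (x y : A) : 𝓐.rmul y (𝓐.coR.ρ x) = 𝓐.coR.ρ (x * y) := by
  obtain ⟨u, hu⟩ := quo_surjective _ _ (𝓐.coR.ρ x)
  obtain ⟨v, hv⟩ := quo_surjective _ _ (𝓐.coR.ρ y)
  rw [𝓐.coR_mul x y u v hu hv, ← hu]
  clear hu
  induction u with
  | zero => simp
  | add u u' h h' => simp only [map_add, add_mul, h, h']
  | tmul a h =>
    rw [quo_tmul, rmul, lift_tmul, rmulAux, LinearMap.mk₂_apply, ← hv]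
    clear hv
    induction v with
    | zero => simp
    | add u u' h h' => simp only [map_add, mul_add, h, h']
    | tmul a h => simp

theorem rmul_leftA (x y : A) (w : BTensor 𝓐.actR 𝓗.bimodR.left) :
    𝓐.rmul y (𝓐.leftA x w) = 𝓐.leftA x (𝓐.rmul y w) := by
  induction w using tensor_induction with
  | zero => simp
  | add u v hu hv => simp only [map_add, hu, hv]
  | tmul m h =>
    simp only [leftA_tmul, rmul, lift_tmul, rmulAux, LinearMap.mk₂_apply]
    generalize 𝓐.coR.ρ y = z
    induction z using tensor_induction with
    | zero => simp
    | add u v hu hv => simp only [map_add, hu, hv]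
    | tmul m h => simp

theorem coR_counit (a : A) :
    lift 𝓐.actR 𝓗.bimodR.left (rightEval 𝓐.actR 𝓗.πR)
      (rightEval_balanced 𝓐.actR 𝓗.bimodR 𝓗.πR 𝓗.right.coring.ε_left) (𝓐.coR.ρ a) = a :=
  𝓐.coR.counit a

theorem coL_counit (a : A) :
    lift 𝓐.actL 𝓗.bimodL.left (rightEval 𝓐.actL 𝓗.πL)
      (rightEval_balanced 𝓐.actL 𝓗.bimodL 𝓗.πL 𝓗.left.coring.ε_left) (𝓐.coL.ρ a) = a :=
  𝓐.coL.counit a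

theorem coR_coinvariant (b : 𝓐.coinvariants) :
    𝓐.coR.ρ b = tmul 𝓐.actR 𝓗.bimodR.left (b : A) 1 := b.2

/-! ### Coinvariants of the right coaction are coinvariants of the left coaction -/

/-- Right multiplication on the second factor of `A ⊗_L H`. -/
def mulSnd : H →ₗ[k] BTensor 𝓐.actL 𝓗.bimodL.left →ₗ[k] BTensor 𝓐.actL 𝓗.bimodL.left :=
  LinearMap.mk₂ k (fun h w => map LinearMap.id (LinearMap.mulRight k h) (fun _ _ => rfl)
      (leftBimod_left_mul 𝓗.left.s 𝓗.left.t 𝓗.left.st h) w)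
    (by
      intro h h' w
      rw [← LinearMap.add_apply]
      exact tensor_ext_apply _ _ (fun m n => by simp [mul_add]) _)
    (by
      intro c h w
      rw [← LinearMap.smul_apply]
      exact tensor_ext_apply _ _ (fun m n => by simp) _)
    (by simp) (by simp)

@[simp]
theorem mulSnd_tmul (h : H) (x : A) (y : H) :
    𝓐.mulSnd h (tmul 𝓐.actL 𝓗.bimodL.left x y) = tmul 𝓐.actL 𝓗.bimodL.left x (y * h) := by
  simp [mulSnd]

/-- Right R-linearity of ρ_L puts a factor s_R(r) at the end of the second leg, and S(h t_R(r)) =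
s_R(r) S(h) absorbs it. This makes `antipodeTwist` well defined. -/
theorem mulSnd_coL_balanced (m : A) (r : R) (h : H) :
    𝓐.mulSnd (𝓗.S h) (𝓐.coL.ρ (𝓐.actR (op r) m))
      = 𝓐.mulSnd (𝓗.S (𝓗.bimodR.left r h)) (𝓐.coL.ρ m) := by
  have hS := 𝓗.S_tL_tR 1 r h
  simp only [op_one, map_one, one_mul, mul_one] at hS
  rw [𝓐.coL_linear, rightBimod_left, hS]
  generalize 𝓐.coL.ρ m = z
  induction z using tensor_induction with
  | zero => simp
  | add u v hu hv => simp only [map_add, hu, hv]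
  | tmul x y => simp [mul_assoc]

/-- The map `A ⊗_R H → A ⊗_L H`, `m ⊗ h ↦ m₍₀₎ ⊗ m₍₁₎ S(h)`. -/
def antipodeTwist : BTensor 𝓐.actR 𝓗.bimodR.left →ₗ[k] BTensor 𝓐.actL 𝓗.bimodL.left :=
  lift _ _ (LinearMap.flip (𝓐.mulSnd.compl₁₂ 𝓗.S 𝓐.coL.ρ)) fun m r h => by
    simpa only [LinearMap.flip_apply, LinearMap.compl₁₂_apply] using 𝓐.mulSnd_coL_balanced m r h

theorem antipodeTwist_tmul (m : A) (h : H) :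
    𝓐.antipodeTwist (tmul 𝓐.actR 𝓗.bimodR.left m h) = 𝓐.mulSnd (𝓗.S h) (𝓐.coL.ρ m) := by
  rw [antipodeTwist, lift_tmul, LinearMap.flip_apply, LinearMap.compl₁₂_apply]

theorem S_one : 𝓗.S 1 = 1 := by
  have := 𝓗.S_left 1
  rw [𝓗.left.Δ_one] at this
  simpa [𝓗.right.ε_one] using this

/-- By mixed coassociativity a⁽⁰⁾₍₀₎ ⊗ a⁽⁰⁾₍₁₎ S(a⁽¹⁾) = a₍₀₎ ⊗ a₍₁₎⁽¹⁾ S(a₍₁₎⁽²⁾) = a₍₀₎ ⊗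
s_L(π_L(a₍₁₎)). The last factor moves across the tensor sign and counitality of ρ_L applies. -/
theorem antipodeTwist_coR (a : A) :
    𝓐.antipodeTwist (𝓐.coR.ρ a) = tmul 𝓐.actL 𝓗.bimodL.left a 1 := by
  let T : BTensor 𝓗.bimodR.right 𝓗.bimodR.left →ₗ[k] H :=
    mulMap _ _ LinearMap.id 𝓗.S (𝓗.antipode_balanced_right 𝓗.S 𝓗.S_tL_tR)
  have hT : ∀ l w, T (leftOn 𝓗.bimodLR 𝓗.bimodR.left l w) = 𝓗.bimodL.left l (T w) := by
    intro l w
    induction w using tensor_induction with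
    | zero => simp
    | add u v hu hv => simp only [map_add, hu, hv]
    | tmul x y => simp [T, mul_assoc]
  let F : BTensor 𝓐.actL (leftOn 𝓗.bimodLR 𝓗.bimodR.left) →ₗ[k] BTensor 𝓐.actL 𝓗.bimodL.left :=
    map LinearMap.id T (fun _ _ => rfl) hT
  have h := congrArg F (𝓐.compat_LR a)
  have h1 : ∀ z, F (assoc 𝓐.actL 𝓗.bimodLR 𝓗.bimodR.left
      (map 𝓐.coL.ρ LinearMap.id 𝓐.coL_linear (fun _ _ => rfl) z)) = 𝓐.antipodeTwist z := by
    intro z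
    induction z using tensor_induction with
    | zero => simp
    | add u v hu hv => simp only [map_add, hu, hv]
    | tmul x y =>
      rw [map_tmul, antipodeTwist_tmul]
      generalize 𝓐.coL.ρ x = w
      induction w using tensor_induction with
      | zero => simp
      | add u v hu hv => simp only [map_add, LinearMap.add_apply, hu, hv]
      | tmul x' y' => simp [F, T]
  rw [h1] at h
  rw [h]
  conv_rhs => rw [← 𝓐.coL_counit a]
  generalize 𝓐.coL.ρ a = z
  induction z using tensor_induction with
  | zero => simp
  | add u v hu hv => simp only [map_add, LinearMap.add_apply, hu, hv]
  | tmul x y =>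
    have h2 : T (𝓗.γR y) = 𝓗.left.s (𝓗.πL y) := 𝓗.S_right y
    simp [F, h2, tmul_balanced]

/-- If ρ_R(b) = b ⊗ 1, then `antipodeTwist` sends it to b₍₀₎ ⊗ b₍₁₎ S(1) = ρ_L(b), while
`antipodeTwist_coR` evaluates the same element to b ⊗ 1. -/
theorem coL_coinvariant (b : 𝓐.coinvariants) :
    𝓐.coL.ρ b = tmul 𝓐.actL 𝓗.bimodL.left (b : A) 1 := by
  rw [← 𝓐.antipodeTwist_coR, coR_coinvariant, antipodeTwist_tmul, S_one]
  generalize 𝓐.coL.ρ b = z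
  induction z using tensor_induction with
  | zero => simp
  | add u v hu hv => simp only [map_add, ← hu, ← hv]
  | tmul x y => simp

/-! ### Left `A`-linear maps on `A ⊗_R H` -/

/-- The map `g : H → A` satisfies `g(h t_R(r)) = η_R(r) g(h)`. -/
def IsLinearR (g : H →ₗ[k] A) : Prop :=
  ∀ r h, g (h * 𝓗.right.t (op r)) = 𝓐.ηR r * g h

variable {𝓐}

/-- The left `A`-linear map `A ⊗_R H → A`, `a ⊗ h ↦ a g(h)`. -/
def extend {g : H →ₗ[k] A} (hg : 𝓐.IsLinearR g) : BTensor 𝓐.actR 𝓗.bimodR.left →ₗ[k] A :=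
  mulMap 𝓐.actR 𝓗.bimodR.left LinearMap.id g fun m r h => by
    rw [LinearMap.id_apply, LinearMap.id_apply, rightBimod_left, hg, 𝓐.actR_eq, mul_assoc]

@[simp]
theorem extend_tmul {g : H →ₗ[k] A} (hg : 𝓐.IsLinearR g) (a : A) (h : H) :
    extend hg (tmul 𝓐.actR 𝓗.bimodR.left a h) = a * g h := by
  simp [extend]

theorem extend_leftA {g : H →ₗ[k] A} (hg : 𝓐.IsLinearR g) (a : A)
    (w : BTensor 𝓐.actR 𝓗.bimodR.left) : extend hg (𝓐.leftA a w) = a * extend hg w := by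
  induction w using tensor_induction with
  | zero => simp
  | add u v hu hv => simp only [map_add, mul_add, hu, hv]
  | tmul m h => simp [mul_assoc]

/-- The map `a ↦ a⁽⁰⁾ g(a⁽¹⁾)`. -/
def sharp {g : H →ₗ[k] A} (hg : 𝓐.IsLinearR g) : A →ₗ[k] A := extend hg ∘ₗ 𝓐.coR.ρ

theorem sharp_apply {g : H →ₗ[k] A} (hg : 𝓐.IsLinearR g) (a : A) :
    sharp hg a = extend hg (𝓐.coR.ρ a) := rfl

/-- The map `h ↦ f(h₍₁₎) g(h₍₂₎)`. -/
def convL (f g : H →ₗ[k] A) (hfg : ∀ x l y, f (𝓗.bimodL.right (op l) x) * g y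
    = f x * g (𝓗.bimodL.left l y)) : H →ₗ[k] A :=
  mulMap 𝓗.bimodL.right 𝓗.bimodL.left f g hfg ∘ₗ 𝓗.γL

variable {f g : H →ₗ[k] A}

/-- The R-action sits on the first leg only, so the convolution product inherits `IsLinearR` from
its left factor. -/
theorem mulMap_leftOn (hf : 𝓐.IsLinearR f) (hfg : ∀ x l y, f (𝓗.bimodL.right (op l) x) * g y
    = f x * g (𝓗.bimodL.left l y)) (r : R) (w : BTensor 𝓗.bimodL.right 𝓗.bimodL.left) :
    mulMap 𝓗.bimodL.right 𝓗.bimodL.left f g hfg (leftOn 𝓗.bimodRL 𝓗.bimodL.left r w)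
      = 𝓐.ηR r * mulMap 𝓗.bimodL.right 𝓗.bimodL.left f g hfg w := by
  induction w using tensor_induction with
  | zero => simp
  | add u v hu hv => simp only [map_add, mul_add, hu, hv]
  | tmul x y => simp [hf r x, mul_assoc]

theorem IsLinearR.convL (hf : 𝓐.IsLinearR f) (hfg : ∀ x l y, f (𝓗.bimodL.right (op l) x) * g y
    = f x * g (𝓗.bimodL.left l y)) : 𝓐.IsLinearR (convL f g hfg) := by
  intro r h
  have := 𝓗.γL_mul_tR r h
  rw [rightBimod_left] at this
  simp only [ComoduleAlgebra.convL, LinearMap.comp_apply]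
  rw [this, mulMap_leftOn hf]

/-- Right L-linearity of ρ_R moves l to the H-factor, where the balancedness of f and g applies. -/
theorem sharp_actL_mul (hf : 𝓐.IsLinearR f) (hfg : ∀ x l y, f (𝓗.bimodL.right (op l) x) * g y
    = f x * g (𝓗.bimodL.left l y)) (a : A) (l : L) (y : H) :
    sharp hf (𝓐.actL (op l) a) * g y = sharp hf a * g (𝓗.bimodL.left l y) := by
  rw [sharp_apply, sharp_apply, 𝓐.coR_linear]
  generalize 𝓐.coR.ρ a = z
  induction z using tensor_induction with
  | zero => simp
  | add u v hu hv => simp only [map_add, add_mul, hu, hv]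
  | tmul x h =>
    rw [rightOn_tmul, extend_tmul, extend_tmul, mul_assoc, hfg, mul_assoc]

/-- `a₍₀₎⁽⁰⁾ f(a₍₀₎⁽¹⁾) g(a₍₁₎) = a⁽⁰⁾ f(a⁽¹⁾₍₁₎) g(a⁽¹⁾₍₂₎)` -/
theorem sharp_mul_coL (hf : 𝓐.IsLinearR f) (hfg : ∀ x l y, f (𝓗.bimodL.right (op l) x) * g y
    = f x * g (𝓗.bimodL.left l y)) (a : A) :
    mulMap 𝓐.actL 𝓗.bimodL.left (sharp hf) g (sharp_actL_mul hf hfg) (𝓐.coL.ρ a)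
      = extend (hf.convL hfg) (𝓐.coR.ρ a) := by
  -- F sends a ⊗ (x ⊗ y) to a f(x) g(y); the claim is F applied to (ρ_R ⊗ H) ρ_L = (A ⊗ γ_L) ρ_R.
  let F : BTensor 𝓐.actR (leftOn 𝓗.bimodRL 𝓗.bimodL.left) →ₗ[k] A :=
    mulMap _ _ LinearMap.id (mulMap 𝓗.bimodL.right 𝓗.bimodL.left f g hfg) fun m r w => by
      rw [mulMap_leftOn hf, LinearMap.id_apply, LinearMap.id_apply, 𝓐.actR_eq, mul_assoc]
  have h1 : ∀ z, F (assoc 𝓐.actR 𝓗.bimodRL 𝓗.bimodL.left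
      (map 𝓐.coR.ρ LinearMap.id 𝓐.coR_linear (fun _ _ => rfl) z))
      = mulMap 𝓐.actL 𝓗.bimodL.left (sharp hf) g (sharp_actL_mul hf hfg) z := by
    intro z
    induction z using tensor_induction with
    | zero => simp
    | add u v hu hv => simp only [map_add, hu, hv]
    | tmul x y =>
      rw [map_tmul, mulMap_tmul, sharp_apply]
      generalize 𝓐.coR.ρ x = w
      induction w using tensor_induction with
      | zero => simp
      | add u v hu hv => simp only [map_add, LinearMap.add_apply, add_mul, hu, hv]
      | tmul x' y' => simp [F, mul_assoc]
  rw [← h1, 𝓐.compat_RL]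
  exact tensor_ext_apply (F ∘ₗ map LinearMap.id 𝓗.γL (fun _ _ => rfl) 𝓗.γL_mul_tR)
    (extend (hf.convL hfg)) (fun m h => by simp [F, convL]) _

theorem extend_counit (hg : 𝓐.IsLinearR g) (h : ∀ x, g x = 𝓐.ηR (𝓗.πR x)) (a : A) :
    extend hg (𝓐.coR.ρ a) = a := by
  conv_rhs => rw [← 𝓐.coR_counit a]
  exact tensor_ext_apply _ _ (fun m x => by simp [h, 𝓐.actR_eq]) _

/-! ### Cleft extensions are Galois -/

variable {ηL : L →ₐ[k] 𝓐.coinvariants} {j j' : H →ₗ[k] A}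

theorem IsBimoduleMapRL.isLinearR (hj' : 𝓐.IsBimoduleMapRL ηL j') : 𝓐.IsLinearR j' := by
  intro r h
  simpa using hj' 1 r h

theorem IsBimoduleMapRL.mul_ηL (hj' : 𝓐.IsBimoduleMapRL ηL j') (l : L) (h : H) :
    j' (𝓗.left.t (op l) * h) = j' h * ηL l := by
  simpa using hj' l 1 h

theorem IsBimoduleMapLR.ηL_mul (hj : 𝓐.IsBimoduleMapLR ηL j) (l : L) (h : H) :
    j (𝓗.left.s l * h) = ηL l * j h := by
  simpa using hj l 1 h

section Colinear

variable (hj : IsColinear (regularComodule 𝓗) 𝓐.toRightComodule j)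

include hj

theorem actR_of_colinear (r : R) (h : H) :
    j (𝓗.bimodR.right (op r) h) = 𝓐.actR (op r) (j h) := hj.right.linear r h

theorem actL_of_colinear (l : L) (h : H) :
    j (𝓗.bimodL.right (op l) h) = 𝓐.actL (op l) (j h) := hj.left.linear l h

theorem coR_of_colinear (h : H) : 𝓐.coR.ρ (j h)
    = map j LinearMap.id (actR_of_colinear hj) (fun _ _ => rfl) (𝓗.γR h) :=
  hj.right.colinear h

theorem coL_of_colinear (h : H) : 𝓐.coL.ρ (j h)
    = map j LinearMap.id (actL_of_colinear hj) (fun _ _ => rfl) (𝓗.γL h) :=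
  hj.left.colinear h

end Colinear

/-! ### The map a ↦ a⁽⁰⁾ j'(a⁽¹⁾) takes values in the coinvariants -/

namespace IsConvolutionInverse

variable (c : 𝓐.IsConvolutionInverse ηL j j')

include c

theorem sharp_actL (l : L) (a : A) :
    sharp c.bimod'.isLinearR (𝓐.actL (op l) a) = sharp c.bimod'.isLinearR a * ηL l := by
  rw [sharp_apply, sharp_apply, 𝓐.coR_linear]
  generalize 𝓐.coR.ρ a = z
  induction z using tensor_induction with
  | zero => simp
  | add u v hu hv => simp only [map_add, add_mul, hu, hv]
  | tmul x h =>
    rw [rightOn_tmul, extend_tmul, extend_tmul, leftBimod_right, c.bimod'.mul_ηL, mul_assoc]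

/-- In a⁽⁰⁾ (j' * j)(a⁽¹⁾) the convolution product is η_R π_R, and the counit of ρ_R returns a. This
expansion of a drives both the Galois and the normal basis argument. -/
theorem sharp_mul (a : A) :
    mulMap 𝓐.actL 𝓗.bimodL.left (sharp c.bimod'.isLinearR) j
      (sharp_actL_mul c.bimod'.isLinearR (conv_balanced_L c.bimod c.bimod')) (𝓐.coL.ρ a) = a :=
  (sharp_mul_coL _ (conv_balanced_L c.bimod c.bimod') a).trans (extend_counit _ c.left_inv a)

/-- The map `a ⊗ w ↦ a⁽⁰⁾ j'(a⁽¹⁾) G(w)` on `A ⊗_L (H ⊗_R H)`. -/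
def contract (G : BTensor 𝓗.bimodR.right 𝓗.bimodR.left →ₗ[k] BTensor 𝓐.actR 𝓗.bimodR.left)
    (hG : ∀ l w, G (leftOn 𝓗.bimodLR 𝓗.bimodR.left l w) = 𝓐.leftA (ηL l) (G w)) :
    BTensor 𝓐.actL (leftOn 𝓗.bimodLR 𝓗.bimodR.left) →ₗ[k] BTensor 𝓐.actR 𝓗.bimodR.left :=
  lift _ _ (𝓐.leftA.toLinearMap.compl₁₂ (sharp c.bimod'.isLinearR) G) fun m l w => by
    simp [hG, c.sharp_actL]

theorem contract_tmul
    (G : BTensor 𝓗.bimodR.right 𝓗.bimodR.left →ₗ[k] BTensor 𝓐.actR 𝓗.bimodR.left)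
    (hG : ∀ l w, G (leftOn 𝓗.bimodLR 𝓗.bimodR.left l w) = 𝓐.leftA (ηL l) (G w)) (a : A)
    (w : BTensor 𝓗.bimodR.right 𝓗.bimodR.left) :
    c.contract G hG (tmul 𝓐.actL (leftOn 𝓗.bimodLR 𝓗.bimodR.left) a w)
      = 𝓐.leftA (sharp c.bimod'.isLinearR a) (G w) := by
  simp [contract]

/-- The map `a ⊗ h ↦ a⁽⁰⁾ j'(a⁽¹⁾) ρ_R(j(h))` on `A ⊗_L H`. -/
def sharpCoR : BTensor 𝓐.actL 𝓗.bimodL.left →ₗ[k] BTensor 𝓐.actR 𝓗.bimodR.left :=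
  lift _ _ (𝓐.leftA.toLinearMap.compl₁₂ (sharp c.bimod'.isLinearR) (𝓐.coR.ρ ∘ₗ j))
    fun m l h => by
      simp [c.sharp_actL, c.bimod.ηL_mul, coR_coinvariant_mul]

theorem sharpCoR_tmul (a : A) (h : H) :
    c.sharpCoR (tmul 𝓐.actL 𝓗.bimodL.left a h)
      = 𝓐.leftA (sharp c.bimod'.isLinearR a) (𝓐.coR.ρ (j h)) := by
  simp [sharpCoR]

/-- This would follow from `sharp_mul` if a♯ were known to be coinvariant, but it is needed to prove
that. Instead, colinearity of j and mixed coassociativity rewrite a₍₀₎♯ j(a₍₁₎⁽¹⁾) ⊗ a₍₁₎⁽²⁾ as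
a⁽⁰⁾₍₀₎♯ j(a⁽⁰⁾₍₁₎) ⊗ a⁽¹⁾, and `sharp_mul` is applied to a⁽⁰⁾. -/
theorem sharpCoR_coL (hj : IsColinear (regularComodule 𝓗) 𝓐.toRightComodule j) (a : A) :
    c.sharpCoR (𝓐.coL.ρ a) = 𝓐.coR.ρ a := by
  let G : BTensor 𝓗.bimodR.right 𝓗.bimodR.left →ₗ[k] BTensor 𝓐.actR 𝓗.bimodR.left :=
    map j LinearMap.id (actR_of_colinear hj) (fun _ _ => rfl)
  have hG : ∀ l w, G (leftOn 𝓗.bimodLR 𝓗.bimodR.left l w) = 𝓐.leftA (ηL l) (G w) := by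
    intro l w
    induction w using tensor_induction with
    | zero => simp
    | add u v hu hv => simp only [map_add, hu, hv]
    | tmul x y =>
      rw [leftOn_tmul]
      simp only [G]
      rw [map_tmul, map_tmul, leftA_tmul]
      exact congrArg (tmul _ _ · y) (c.bimod.ηL_mul l x)
  have hγ : ∀ h, G (𝓗.γR h) = 𝓐.coR.ρ (j h) := fun h => (coR_of_colinear hj h).symm
  have h1 : ∀ z, c.contract G hG (assoc 𝓐.actL 𝓗.bimodLR 𝓗.bimodR.left
      (map 𝓐.coL.ρ LinearMap.id 𝓐.coL_linear (fun _ _ => rfl) z)) = z := by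
    intro z
    induction z using tensor_induction with
    | zero => simp
    | add u v hu hv => simp only [map_add, hu, hv]
    | tmul x y =>
      rw [map_tmul]
      conv_rhs => rw [← c.sharp_mul x]
      generalize 𝓐.coL.ρ x = w
      induction w using tensor_induction with
      | zero => simp
      | add u v hu hv => simp only [map_add, LinearMap.add_apply, hu, hv]
      | tmul x' y' =>
        rw [assoc_tmul, mulMap_tmul]
        refine (c.contract_tmul G hG _ _).trans ?_
        exact (congrArg _ (map_tmul ..)).trans (leftA_tmul ..)
  rw [← h1 (𝓐.coR.ρ a), 𝓐.compat_LR]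
  exact tensor_ext_apply c.sharpCoR (c.contract G hG ∘ₗ map LinearMap.id 𝓗.γR
    (fun _ _ => rfl) 𝓗.γR_sL_mul) (fun m h => by
      rw [LinearMap.comp_apply, map_tmul, sharpCoR_tmul, ← hγ]
      exact (c.contract_tmul G hG _ _).symm) _

/-- By `sharpCoR_coL`, ρ_R(a♯) = ρ_R(a⁽⁰⁾) ρ_R(j'(a⁽¹⁾)) = a⁽⁰⁾₍₀₎♯ ρ_R(j(a⁽⁰⁾₍₁₎) j'(a⁽¹⁾)). Mixed
coassociativity turns this into a₍₀₎♯ ρ_R((j * j')(a₍₁₎)), where j * j' = η_L π_L has values in B.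
-/
theorem sharp_mem (hj : IsColinear (regularComodule 𝓗) 𝓐.toRightComodule j) (a : A) :
    sharp c.bimod'.isLinearR a ∈ 𝓐.coinvariants := by
  let m : BTensor 𝓗.bimodR.right 𝓗.bimodR.left →ₗ[k] A :=
    mulMap 𝓗.bimodR.right 𝓗.bimodR.left j j' (conv_balanced_R c.bimod c.bimod')
  have hm : ∀ l w, m (leftOn 𝓗.bimodLR 𝓗.bimodR.left l w) = ηL l * m w := by
    intro l w
    induction w using tensor_induction with
    | zero => simp
    | add u v hu hv => simp only [map_add, mul_add, hu, hv]
    | tmul x y => simp [m, c.bimod.ηL_mul, mul_assoc]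
  let G : BTensor 𝓗.bimodR.right 𝓗.bimodR.left →ₗ[k] BTensor 𝓐.actR 𝓗.bimodR.left :=
    𝓐.coR.ρ ∘ₗ m
  have hG : ∀ l w, G (leftOn 𝓗.bimodLR 𝓗.bimodR.left l w) = 𝓐.leftA (ηL l) (G w) := by
    intro l w
    simp only [G, LinearMap.comp_apply, hm, coR_coinvariant_mul]
  have hγ : ∀ h, G (𝓗.γR h) = tmul _ _ (ηL (𝓗.πL h) : A) 1 := fun h =>
    (congrArg 𝓐.coR.ρ (c.right_inv h)).trans (𝓐.coR_coinvariant _)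
  have h1 : ∀ z, c.contract G hG (assoc 𝓐.actL 𝓗.bimodLR 𝓗.bimodR.left
      (map 𝓐.coL.ρ LinearMap.id 𝓐.coL_linear (fun _ _ => rfl) z))
      = 𝓐.coR.ρ (extend c.bimod'.isLinearR z) := by
    intro z
    induction z using tensor_induction with
    | zero => simp
    | add u v hu hv => simp only [map_add, hu, hv]
    | tmul x y =>
      rw [map_tmul, extend_tmul, ← rmul_coR, ← c.sharpCoR_coL hj x]
      generalize 𝓐.coL.ρ x = w
      induction w using tensor_induction with
      | zero => simp
      | add u v hu hv => simp only [map_add, LinearMap.add_apply, hu, hv]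
      | tmul x' y' =>
        rw [assoc_tmul, sharpCoR_tmul, rmul_leftA, rmul_coR]
        refine (c.contract_tmul G hG _ _).trans ?_
        exact congrArg (fun t => 𝓐.leftA _ (𝓐.coR.ρ t)) (mulMap_tmul ..)
  have h2 := h1 (𝓐.coR.ρ a)
  rw [𝓐.compat_LR] at h2
  -- What remains is a₍₀₎♯ η_L(π_L(a₍₁₎)) ⊗ 1; right L-linearity of ♯ and the counit of ρ_L reduce
  -- it to a♯ ⊗ 1.
  refine h2.symm.trans ?_
  conv_rhs => rw [← 𝓐.coL_counit a]
  generalize 𝓐.coL.ρ a = z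
  induction z using tensor_induction with
  | zero => simp
  | add u v hu hv => simp only [map_add, LinearMap.add_apply, hu, hv]
  | tmul x y =>
    rw [map_tmul, lift_tmul, rightEval_apply, c.sharp_actL]
    refine (c.contract_tmul G hG _ _).trans ?_
    exact (congrArg _ (hγ y)).trans (leftA_tmul ..)

/-! The inverse of the canonical map is `a ⊗ h ↦ a j'(h₍₁₎) ⊗ j(h₍₂₎)`. -/

end IsConvolutionInverse

/-! ### Left A-linearity of the canonical map and left B-linearity of the L-action and of ρ_L -/

variable (𝓐)

theorem can_tmul (a a' : A) :
    𝓐.can (tmul 𝓐.rightB 𝓐.leftB a a') = 𝓐.leftA a (𝓐.coR.ρ a') := by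
  rw [can, lift_tmul]
  rfl

theorem rightB_apply (b : 𝓐.coinvariants) (a : A) : 𝓐.rightB (op b) a = a * b := rfl

theorem leftB_apply (b : 𝓐.coinvariants) (a : A) : 𝓐.leftB b a = b * a := rfl

theorem rightL_apply (ηL : L →ₐ[k] 𝓐.coinvariants) (l : L) (b : 𝓐.coinvariants) :
    𝓐.rightL ηL (op l) b = b * ηL l := rfl

/-- `A ⊗_B A` as a left `A`-module. -/
def leftAB : LeftAct k A (BTensor 𝓐.rightB 𝓐.leftB) :=
  actFst 𝓐.rightB 𝓐.leftB (leftMul k A) fun a b x => by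
    simp [rightB, mul_assoc]

@[simp]
theorem leftAB_tmul (a x y : A) :
    𝓐.leftAB a (tmul 𝓐.rightB 𝓐.leftB x y) = tmul 𝓐.rightB 𝓐.leftB (a * x) y := by
  simp [leftAB]

theorem can_leftAB (a : A) (w : BTensor 𝓐.rightB 𝓐.leftB) :
    𝓐.can (𝓐.leftAB a w) = 𝓐.leftA a (𝓐.can w) := by
  induction w using tensor_induction with
  | zero => simp
  | add u v hu hv => simp only [map_add, hu, hv]
  | tmul x y => simp [can_tmul]

theorem coR_injective : Function.Injective 𝓐.coR.ρ := fun a a' h => by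
  rw [← 𝓐.coR_counit a, h, 𝓐.coR_counit]

/-- The right L-action on A is not given by multiplication, so this needs an argument: after the
injective map ρ_R, l acts on the H-factor and b on the A-factor. -/
theorem actL_coinvariant_mul (b : 𝓐.coinvariants) (l : L) (a : A) :
    𝓐.actL (op l) (b * a) = b * 𝓐.actL (op l) a := by
  apply 𝓐.coR_injective
  rw [coR_coinvariant_mul, 𝓐.coR_linear, 𝓐.coR_linear, coR_coinvariant_mul]
  generalize 𝓐.coR.ρ a = z
  induction z using tensor_induction with
  | zero => simp
  | add u v hu hv => simp only [map_add, hu, hv]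
  | tmul x h => rw [leftA_tmul, rightOn_tmul, rightOn_tmul, leftA_tmul]

theorem mulLeft_actL (b : 𝓐.coinvariants) (l : L) (a : A) :
    LinearMap.mulLeft k (b : A) (𝓐.actL (op l) a)
      = 𝓐.actL (op l) (LinearMap.mulLeft k (b : A) a) :=
  (𝓐.actL_coinvariant_mul b l a).symm

/-- Multiplicativity of ρ_L together with ρ_L(b) = b ⊗ 1, the one place where `coL_coinvariant` is
used. -/
theorem coL_coinvariant_mul (b : 𝓐.coinvariants) (a : A) :
    𝓐.coL.ρ (b * a) = map (LinearMap.mulLeft k (b : A)) LinearMap.id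
      (𝓐.mulLeft_actL b) (fun _ _ => rfl) (𝓐.coL.ρ a) := by
  obtain ⟨v, hv⟩ := quo_surjective _ _ (𝓐.coL.ρ a)
  rw [𝓐.coL_mul b a ((b : A) ⊗ₜ 1) v (𝓐.coL_coinvariant b).symm hv, ← hv]
  clear hv
  induction v with
  | zero => simp
  | tmul x y => simp
  | add u v hu hv => simp only [mul_add, map_add, hu, hv]

variable {𝓐}

/-! ### Bijectivity of the canonical map for a cleft extension -/

namespace IsConvolutionInverse

variable (c : 𝓐.IsConvolutionInverse ηL j j')

include c

/-- The map `H ⊗_L H → A ⊗_B A`, `x ⊗ y ↦ j'(x) ⊗ j(y)`. -/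
def tensorMap : BTensor 𝓗.bimodL.right 𝓗.bimodL.left →ₗ[k] BTensor 𝓐.rightB 𝓐.leftB :=
  lift _ _ ((tmul 𝓐.rightB 𝓐.leftB).compl₁₂ j' j) fun x l y => by
    simp only [LinearMap.compl₁₂_apply, leftBimod_left, leftBimod_right, c.bimod'.mul_ηL,
      c.bimod.ηL_mul]
    exact tmul_balanced 𝓐.rightB 𝓐.leftB (j' x) (ηL l) (j y)

theorem tensorMap_tmul (x y : H) : c.tensorMap (tmul 𝓗.bimodL.right 𝓗.bimodL.left x y)
    = tmul 𝓐.rightB 𝓐.leftB (j' x) (j y) := by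
  simp [tensorMap]

/-- The element t_R(r) acts on the first leg, where j' converts it into left multiplication by
η_R(r); this is the balancedness required for `canInv`. -/
theorem tensorMap_leftOn (r : R) (w : BTensor 𝓗.bimodL.right 𝓗.bimodL.left) :
    c.tensorMap (leftOn 𝓗.bimodRL 𝓗.bimodL.left r w) = 𝓐.leftAB (𝓐.ηR r) (c.tensorMap w) := by
  induction w using tensor_induction with
  | zero => simp
  | add u v hu hv => simp only [map_add, hu, hv]
  | tmul x y =>
    rw [leftOn_tmul, rightBimod_left, tensorMap_tmul]
    refine (c.tensorMap_tmul _ _).trans ?_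
    rw [c.bimod'.isLinearR]
    exact ((congrArg _ (c.tensorMap_tmul x y)).trans (leftAB_tmul ..)).symm

/-- The inverse of the canonical map, `a ⊗ h ↦ a j'(h₍₁₎) ⊗ j(h₍₂₎)`. -/
def canInv : BTensor 𝓐.actR 𝓗.bimodR.left →ₗ[k] BTensor 𝓐.rightB 𝓐.leftB :=
  lift _ _ (𝓐.leftAB.toLinearMap.compl₂ (c.tensorMap ∘ₗ 𝓗.γL)) fun a r h => by
    simp only [LinearMap.compl₂_apply, LinearMap.comp_apply, AlgHom.toLinearMap_apply]
    rw [𝓗.γL_mul_tR, tensorMap_leftOn, 𝓐.actR_eq, map_mul]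
    rfl

theorem canInv_tmul (a : A) (h : H) : c.canInv (tmul 𝓐.actR 𝓗.bimodR.left a h)
    = 𝓐.leftAB a (c.tensorMap (𝓗.γL h)) := by
  rw [canInv, lift_tmul]
  rfl

theorem canInv_leftA (a : A) (w : BTensor 𝓐.actR 𝓗.bimodR.left) :
    c.canInv (𝓐.leftA a w) = 𝓐.leftAB a (c.canInv w) := by
  induction w using tensor_induction with
  | zero => simp
  | add u v hu hv => simp only [map_add, hu, hv]
  | tmul x h => rw [leftA_tmul, canInv_tmul, canInv_tmul, map_mul, Module.End.mul_apply]

/-- Mixed coassociativity rewrites a⁽⁰⁾ j'(a⁽¹⁾₍₁₎) ⊗ j(a⁽¹⁾₍₂₎) as a₍₀₎♯ ⊗ j(a₍₁₎). Since the first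
factor lies in B, it crosses the tensor sign and `sharp_mul` finishes. -/
theorem canInv_coR (hj : IsColinear (regularComodule 𝓗) 𝓐.toRightComodule j) (a : A) :
    c.canInv (𝓐.coR.ρ a) = tmul 𝓐.rightB 𝓐.leftB 1 a := by
  let F : BTensor 𝓐.actR (leftOn 𝓗.bimodRL 𝓗.bimodL.left) →ₗ[k] BTensor 𝓐.rightB 𝓐.leftB :=
    lift _ _ (𝓐.leftAB.toLinearMap.compl₂ c.tensorMap) fun a r w => by
      simp only [LinearMap.compl₂_apply, AlgHom.toLinearMap_apply]
      rw [tensorMap_leftOn, 𝓐.actR_eq, map_mul]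
      rfl
  have hF : ∀ (x : A) (w : BTensor 𝓗.bimodL.right 𝓗.bimodL.left),
      F (tmul 𝓐.actR (leftOn 𝓗.bimodRL 𝓗.bimodL.left) x w) = 𝓐.leftAB x (c.tensorMap w) :=
    fun x w => lift_tmul _ _ _ _ _ _
  have h1 : ∀ z, F (assoc 𝓐.actR 𝓗.bimodRL 𝓗.bimodL.left
      (map 𝓐.coR.ρ LinearMap.id 𝓐.coR_linear (fun _ _ => rfl) z))
      = tmul 𝓐.rightB 𝓐.leftB 1 (mulMap 𝓐.actL 𝓗.bimodL.left (sharp c.bimod'.isLinearR) j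
        (sharp_actL_mul c.bimod'.isLinearR (conv_balanced_L c.bimod c.bimod')) z) := by
    intro z
    induction z using tensor_induction with
    | zero => simp
    | add u v hu hv => simp only [map_add, hu, hv]
    | tmul x y =>
      -- `sharp_mem` is what allows x♯ to be moved across the tensor product over B.
      have hb := tmul_balanced 𝓐.rightB 𝓐.leftB 1 ⟨_, c.sharp_mem hj x⟩ (j y)
      simp only [rightB_apply, leftB_apply, one_mul] at hb
      rw [map_tmul, mulMap_tmul, ← hb, sharp_apply]
      generalize 𝓐.coR.ρ x = w
      induction w using tensor_induction with
      | zero => simp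
      | add u v hu hv => simp only [map_add, LinearMap.add_apply, hu, hv]
      | tmul x' y' =>
        rw [assoc_tmul, extend_tmul]
        refine (hF _ _).trans ?_
        exact (congrArg _ (c.tensorMap_tmul _ _)).trans (leftAB_tmul ..)
  conv_rhs => rw [← c.sharp_mul a]
  rw [← h1, 𝓐.compat_RL]
  exact tensor_ext_apply c.canInv (F ∘ₗ map LinearMap.id 𝓗.γL (fun _ _ => rfl) 𝓗.γL_mul_tR)
    (fun m h => by
      rw [LinearMap.comp_apply, map_tmul, canInv_tmul]
      exact (hF _ _).symm) _

/-- Colinearity of j and mixed coassociativity of H give j'(h₍₁₎) j(h₍₂₎⁽¹⁾) ⊗ h₍₂₎⁽²⁾ = j'(h⁽¹⁾₍₁₎)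
j(h⁽¹⁾₍₂₎) ⊗ h⁽²⁾ = η_R(π_R(h⁽¹⁾)) ⊗ h⁽²⁾, and the counit of γ_R leaves 1 ⊗ h. -/
theorem can_tensorMap_γL (hj : IsColinear (regularComodule 𝓗) 𝓐.toRightComodule j) (h : H) :
    𝓐.can (c.tensorMap (𝓗.γL h)) = tmul 𝓐.actR 𝓗.bimodR.left 1 h := by
  let G : BTensor 𝓗.bimodR.right 𝓗.bimodR.left →ₗ[k] BTensor 𝓐.actR 𝓗.bimodR.left :=
    map j LinearMap.id (actR_of_colinear hj) (fun _ _ => rfl)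
  have hG : ∀ l w, G (leftOn 𝓗.bimodLR 𝓗.bimodR.left l w) = 𝓐.leftA (ηL l) (G w) := by
    intro l w
    induction w using tensor_induction with
    | zero => simp
    | add u v hu hv => simp only [map_add, hu, hv]
    | tmul x y =>
      rw [leftOn_tmul]
      simp only [G]
      rw [map_tmul, map_tmul, leftA_tmul]
      exact congrArg (tmul _ _ · y) (c.bimod.ηL_mul l x)
  have hγ : ∀ h, G (𝓗.γR h) = 𝓐.coR.ρ (j h) := fun h => (coR_of_colinear hj h).symm
  let F : BTensor 𝓗.bimodL.right (leftOn 𝓗.bimodLR 𝓗.bimodR.left)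
      →ₗ[k] BTensor 𝓐.actR 𝓗.bimodR.left :=
    lift _ _ (𝓐.leftA.toLinearMap.compl₁₂ j' G) fun x l w => by
      simp [hG, c.bimod'.mul_ηL]
  have hF : ∀ (x : H) (w : BTensor 𝓗.bimodR.right 𝓗.bimodR.left),
      F (tmul 𝓗.bimodL.right (leftOn 𝓗.bimodLR 𝓗.bimodR.left) x w) = 𝓐.leftA (j' x) (G w) :=
    fun x w => lift_tmul _ _ _ _ _ _
  have h1 : ∀ z, F (assoc 𝓗.bimodL.right 𝓗.bimodLR 𝓗.bimodR.left
      (map 𝓗.γL LinearMap.id 𝓗.γL_mul_sR (fun _ _ => rfl) z))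
      = tmul 𝓐.actR 𝓗.bimodR.left 1 (lift _ _ (leftEval 𝓗.bimodR.left 𝓗.πR)
        (leftEval_balanced 𝓗.bimodR 𝓗.bimodR.left 𝓗.πR 𝓗.right.coring.ε_right) z) := by
    intro z
    induction z using tensor_induction with
    | zero => simp
    | add u v hu hv => simp only [map_add, hu, hv]
    | tmul x y =>
      rw [map_tmul, lift_tmul, leftEval_apply, ← tmul_balanced, 𝓐.actR_eq, one_mul,
        ← c.left_inv x]
      generalize 𝓗.γL x = w
      induction w using tensor_induction with
      | zero => simp
      | add u v hu hv => simp only [map_add, LinearMap.add_apply, hu, hv]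
      | tmul x' y' =>
        rw [assoc_tmul, mulMap_tmul]
        refine (hF _ _).trans ?_
        exact (congrArg _ (map_tmul ..)).trans (leftA_tmul ..)
  have h2 := h1 (𝓗.γR h)
  rw [𝓗.colinLR, 𝓗.right.coring.counit_left] at h2
  rw [← h2]
  exact tensor_ext_apply (𝓐.can ∘ₗ c.tensorMap)
    (F ∘ₗ map LinearMap.id 𝓗.γR (fun _ _ => rfl) 𝓗.γR_sL_mul)
    (fun x y => by
      rw [LinearMap.comp_apply, LinearMap.comp_apply, map_tmul, tensorMap_tmul, can_tmul, ← hγ]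
      exact (hF _ _).symm) _

/-- Both `can` and `canInv` are left A-linear, so the composites need checking only on 1 ⊗ a and on
1 ⊗ h. -/
theorem isGalois (hj : IsColinear (regularComodule 𝓗) 𝓐.toRightComodule j) : 𝓐.IsGalois := by
  refine Function.bijective_iff_has_inverse.2 ⟨c.canInv, fun w => ?_, fun w => ?_⟩
  · refine tensor_ext_apply (c.canInv ∘ₗ 𝓐.can) LinearMap.id (fun a a' => ?_) w
    rw [LinearMap.comp_apply, can_tmul, canInv_leftA, c.canInv_coR hj, leftAB_tmul, mul_one,
      LinearMap.id_apply]
  · refine tensor_ext_apply (𝓐.can ∘ₗ c.canInv) LinearMap.id (fun a h => ?_) w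
    rw [LinearMap.comp_apply, canInv_tmul, can_leftAB, c.can_tensorMap_γL hj, leftA_tmul, mul_one,
      LinearMap.id_apply]

/-! ### Cleft extensions have the normal basis property -/

/-- The map `B ⊗_L H → A`, `b ⊗ h ↦ b j(h)`. -/
def fromNormalBasis : 𝓐.NormalBasisModule ηL →ₗ[k] A :=
  mulMap (𝓐.rightL ηL) 𝓗.bimodL.left 𝓐.coinvariants.val.toLinearMap j fun b l h => by
    rw [rightL_apply, leftBimod_left, c.bimod.ηL_mul, ← mul_assoc]
    rfl

theorem fromNormalBasis_tmul (b : 𝓐.coinvariants) (h : H) :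
    c.fromNormalBasis (tmul (𝓐.rightL ηL) 𝓗.bimodL.left b h) = b * j h :=
  mulMap_tmul _ _ _ _ _ _ _

/-- The map `A → B ⊗_L H`, `a ↦ a₍₀₎⁽⁰⁾ j'(a₍₀₎⁽¹⁾) ⊗ a₍₁₎`. -/
def toNormalBasisAux (hj : IsColinear (regularComodule 𝓗) 𝓐.toRightComodule j) :
    BTensor 𝓐.actL 𝓗.bimodL.left →ₗ[k] 𝓐.NormalBasisModule ηL :=
  map ((sharp c.bimod'.isLinearR).codRestrict (Subalgebra.toSubmodule 𝓐.coinvariants)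
    (c.sharp_mem hj)) LinearMap.id (fun l a => Subtype.ext (c.sharp_actL l a)) (fun _ _ => rfl)

/-- Colinearity of j turns j(h)♯ into (j * j')(h). -/
theorem sharp_j (hj : IsColinear (regularComodule 𝓗) 𝓐.toRightComodule j) (h : H) :
    sharp c.bimod'.isLinearR (j h) = ηL (𝓗.πL h) := by
  rw [sharp_apply, coR_of_colinear hj, ← c.right_inv]
  generalize 𝓗.γR h = z
  induction z using tensor_induction with
  | zero => simp
  | add u v hu hv => simp only [map_add, hu, hv]
  | tmul x y =>
    rw [map_tmul, extend_tmul, mulMap_tmul, LinearMap.id_apply]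

theorem sharp_coinvariant_mul (b : 𝓐.coinvariants) (a : A) :
    sharp c.bimod'.isLinearR (b * a) = b * sharp c.bimod'.isLinearR a := by
  rw [sharp_apply, coR_coinvariant_mul, extend_leftA, sharp_apply]

theorem fromNormalBasis_toNormalBasis
    (hj : IsColinear (regularComodule 𝓗) 𝓐.toRightComodule j) (a : A) :
    c.fromNormalBasis (c.toNormalBasisAux hj (𝓐.coL.ρ a)) = a := by
  conv_rhs => rw [← c.sharp_mul a]
  refine tensor_ext_apply (c.fromNormalBasis ∘ₗ c.toNormalBasisAux hj) _ (fun x h => ?_) _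
  rw [LinearMap.comp_apply, toNormalBasisAux, map_tmul, fromNormalBasis_tmul, mulMap_tmul]
  rfl

/-- Left B-linearity of ρ_L and ♯ and colinearity of j give b j(h) ↦ b j(h₍₁₎)♯ ⊗ h₍₂₎ = b
η_L(π_L(h₍₁₎)) ⊗ h₍₂₎, which is b ⊗ h by counitality of γ_L. -/
theorem toNormalBasis_fromNormalBasis
    (hj : IsColinear (regularComodule 𝓗) 𝓐.toRightComodule j) (w : 𝓐.NormalBasisModule ηL) :
    c.toNormalBasisAux hj (𝓐.coL.ρ (c.fromNormalBasis w)) = w := by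
  refine tensor_ext_apply (c.toNormalBasisAux hj ∘ₗ 𝓐.coL.ρ ∘ₗ c.fromNormalBasis) LinearMap.id
    (fun b h => ?_) w
  rw [LinearMap.comp_apply, LinearMap.comp_apply, LinearMap.id_apply, fromNormalBasis_tmul,
    coL_coinvariant_mul, coL_of_colinear hj]
  conv_rhs => rw [← 𝓗.left.coring.counit_left h]
  generalize 𝓗.γL h = z
  induction z using tensor_induction with
  | zero => simp
  | add u v hu hv => simp only [map_add, hu, hv]
  | tmul x y =>
    rw [map_tmul, map_tmul, lift_tmul, leftEval_apply, ← tmul_balanced, rightL_apply,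
      toNormalBasisAux, map_tmul]
    refine congrArg (tmul _ _ · y) (Subtype.ext ?_)
    exact (c.sharp_coinvariant_mul b (j x)).trans (congrArg _ (c.sharp_j hj x))

/-- The isomorphism `B ⊗_L H ≃ A` determined by a cleaving map. -/
def normalBasisEquiv (hj : IsColinear (regularComodule 𝓗) 𝓐.toRightComodule j) :
    𝓐.NormalBasisModule ηL ≃ₗ[k] A :=
  LinearEquiv.ofLinearMap c.fromNormalBasis (c.toNormalBasisAux hj ∘ₗ 𝓐.coL.ρ)
    (LinearMap.ext (c.fromNormalBasis_toNormalBasis hj))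
    (LinearMap.ext (c.toNormalBasis_fromNormalBasis hj))

/-- Both coactions and both base actions on A are left B-linear, so colinearity passes from j to b ⊗
h ↦ b j(h). -/
theorem fromNormalBasis_colinear (hj : IsColinear (regularComodule 𝓗) 𝓐.toRightComodule j) :
    IsColinear (tensorComodule 𝓗 (𝓐.rightL ηL)) 𝓐.toRightComodule c.fromNormalBasis where
  right := by
    have lin : ∀ r y, c.fromNormalBasis (rightOn (𝓐.rightL ηL) 𝓗.bimodLR (op r) y)
        = 𝓐.actR (op r) (c.fromNormalBasis y) := by
      intro r y
      induction y using tensor_induction with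
      | zero => simp
      | add u v hu hv => simp only [map_add, hu, hv]
      | tmul b h =>
        rw [rightOn_tmul, fromNormalBasis_tmul]
        refine (c.fromNormalBasis_tmul _ _).trans ?_
        have h1 := actR_of_colinear hj r h
        rw [𝓐.actR_eq] at h1 ⊢
        exact (congrArg _ h1).trans (mul_assoc ..).symm
    refine ⟨lin, fun y => ?_⟩
    change _ = map c.fromNormalBasis LinearMap.id lin _
      (inducedMap (𝓐.rightL ηL) 𝓗.bimodLR 𝓗.γR 𝓗.γR_sL_mul y)
    induction y using tensor_induction with
    | zero => simp
    | add u v hu hv => simp only [map_add, hu, hv]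
    | tmul b h =>
      rw [fromNormalBasis_tmul, coR_coinvariant_mul, coR_of_colinear hj, inducedMap_tmul]
      generalize 𝓗.γR h = z
      induction z using tensor_induction with
      | zero => simp
      | add u v hu hv => simp only [map_add, hu, hv]
      | tmul x y =>
        rw [map_tmul, map_tmul, map_tmul, leftA_tmul]
        exact congrArg (tmul _ _ · y) (c.fromNormalBasis_tmul b x).symm
  left := by
    have lin : ∀ l y, c.fromNormalBasis (rightOn (𝓐.rightL ηL) 𝓗.bimodL (op l) y)
        = 𝓐.actL (op l) (c.fromNormalBasis y) := by
      intro l y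
      induction y using tensor_induction with
      | zero => simp
      | add u v hu hv => simp only [map_add, hu, hv]
      | tmul b h =>
        rw [rightOn_tmul, fromNormalBasis_tmul, fromNormalBasis_tmul, actL_coinvariant_mul]
        exact congrArg _ (actL_of_colinear hj l h)
    refine ⟨lin, fun y => ?_⟩
    change _ = map c.fromNormalBasis LinearMap.id lin _
      (inducedMap (𝓐.rightL ηL) 𝓗.bimodL 𝓗.γL 𝓗.left.coring.Δ_left y)
    induction y using tensor_induction with
    | zero => simp
    | add u v hu hv => simp only [map_add, hu, hv]
    | tmul b h =>
      rw [fromNormalBasis_tmul, coL_coinvariant_mul, coL_of_colinear hj, inducedMap_tmul]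
      generalize 𝓗.γL h = z
      induction z using tensor_induction with
      | zero => simp
      | add u v hu hv => simp only [map_add, hu, hv]
      | tmul x y =>
        rw [map_tmul, map_tmul, map_tmul, map_tmul]
        exact congrArg (tmul _ _ · y) (c.fromNormalBasis_tmul b x).symm

theorem fromNormalBasis_left (b : 𝓐.coinvariants) (w : 𝓐.NormalBasisModule ηL) :
    c.fromNormalBasis (𝓐.normalBasisLeft ηL b w) = b * c.fromNormalBasis w := by
  induction w using tensor_induction with
  | zero => simp
  | add u v hu hv => simp only [map_add, mul_add, hu, hv]
  | tmul x h =>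
    rw [normalBasisLeft, actFst_tmul, fromNormalBasis_tmul, fromNormalBasis_tmul, ← mul_assoc]
    rfl

theorem hasNormalBasis (hj : IsColinear (regularComodule 𝓗) 𝓐.toRightComodule j) :
    𝓐.HasNormalBasis ηL := by
  have hc : IsColinear (tensorComodule 𝓗 (𝓐.rightL ηL)) 𝓐.toRightComodule
    (c.normalBasisEquiv hj).toLinearMap := c.fromNormalBasis_colinear hj
  refine ⟨(c.normalBasisEquiv hj).symm, fun b a => ?_, hc.right.symm, hc.left.symm⟩
  rw [LinearEquiv.symm_apply_eq]
  refine Eq.trans ?_ (c.fromNormalBasis_left b _).symm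
  exact congrArg _ ((c.normalBasisEquiv hj).apply_symm_apply a).symm

end IsConvolutionInverse
/-! ### Galois extensions with the normal basis property are cleft -/

section NormalBasis

variable (κ : A ≃ₗ[k] 𝓐.NormalBasisModule ηL)

/-- The map `H → A`, `h ↦ κ⁻¹(1 ⊗ h)`. -/
def cleaving : H →ₗ[k] A :=
  κ.symm.toLinearMap ∘ₗ tmul (𝓐.rightL ηL) 𝓗.bimodL.left 1

theorem cleaving_apply (h : H) :
    cleaving κ h = κ.symm (tmul (𝓐.rightL ηL) 𝓗.bimodL.left 1 h) := rfl

/-- The map h ↦ 1 ⊗ h is colinear into B ⊗_L H, and κ⁻¹ is colinear by `IsComoduleMap.symm`. -/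
theorem cleaving_colinear
    (hc : IsColinear 𝓐.toRightComodule (tensorComodule 𝓗 (𝓐.rightL ηL)) κ.toLinearMap) :
    IsColinear (regularComodule 𝓗) 𝓐.toRightComodule (cleaving κ) where
  right := by
    refine ⟨fun r h => Eq.trans ?_
      (hc.right.symm.linear r (tmul (𝓐.rightL ηL) 𝓗.bimodL.left 1 h)), fun h => ?_⟩
    · exact congrArg κ.symm (tmul_right_linear (𝓐.rightL ηL) 𝓗.bimodLR 1 r h)
    · refine (hc.right.symm.colinear (tmul (𝓐.rightL ηL) 𝓗.bimodL.left 1 h)).trans ?_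
      refine (congrArg _ (inducedMap_tmul (𝓐.rightL ηL) 𝓗.bimodLR 𝓗.γR 𝓗.γR_sL_mul 1 h)).trans ?_
      exact map_map _ _ _ _ _ _ _ _ _
  left := by
    refine ⟨fun l h => Eq.trans ?_
      (hc.left.symm.linear l (tmul (𝓐.rightL ηL) 𝓗.bimodL.left 1 h)), fun h => ?_⟩
    · exact congrArg κ.symm (tmul_right_linear (𝓐.rightL ηL) 𝓗.bimodL 1 l h)
    · refine (hc.left.symm.colinear (tmul (𝓐.rightL ηL) 𝓗.bimodL.left 1 h)).trans ?_
      refine (congrArg _ (inducedMap_tmul (𝓐.rightL ηL) 𝓗.bimodL 𝓗.γL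
        𝓗.left.coring.Δ_left 1 h)).trans ?_
      exact map_map _ _ _ _ _ _ _ _ _

variable (hB : ∀ (b : 𝓐.coinvariants) (a : A), κ (b * a) = 𝓐.normalBasisLeft ηL b (κ a))

include hB in
theorem symm_tmul (b : 𝓐.coinvariants) (h : H) :
    κ.symm (tmul (𝓐.rightL ηL) 𝓗.bimodL.left b h) = b * cleaving κ h := by
  rw [LinearEquiv.symm_apply_eq, hB, cleaving_apply, LinearEquiv.apply_symm_apply, normalBasisLeft,
    actFst_tmul]
  exact congrArg (tmul _ _ · h) (mul_one b).symm

include hB in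
theorem cleaving_sL (l : L) (h : H) : cleaving κ (𝓗.left.s l * h) = ηL l * cleaving κ h := by
  rw [← symm_tmul κ hB, cleaving_apply, ← leftBimod_left 𝓗.left.s 𝓗.left.t 𝓗.left.st,
    ← tmul_balanced, rightL_apply, one_mul]

include hB in
theorem cleaving_bimod
    (hc : IsColinear 𝓐.toRightComodule (tensorComodule 𝓗 (𝓐.rightL ηL)) κ.toLinearMap) :
    𝓐.IsBimoduleMapLR ηL (cleaving κ) := by
  intro l r h
  have h1 := actR_of_colinear (cleaving_colinear κ hc) r (𝓗.left.s l * h)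
  rwa [rightBimod_right, unop_op, 𝓐.actR_eq, cleaving_sL κ hB] at h1

/-- The map `A ≃ B ⊗_L H → B`, `b ⊗ h ↦ b η_L(π_L(h))`. -/
def projB : A →ₗ[k] 𝓐.coinvariants :=
  lift (𝓐.rightL ηL) 𝓗.bimodL.left (rightEval (𝓐.rightL ηL) 𝓗.πL)
    (rightEval_balanced (𝓐.rightL ηL) 𝓗.bimodL 𝓗.πL 𝓗.left.coring.ε_left) ∘ₗ κ.toLinearMap

theorem projB_symm_tmul (b : 𝓐.coinvariants) (h : H) :
    projB κ (κ.symm (tmul (𝓐.rightL ηL) 𝓗.bimodL.left b h)) = b * ηL (𝓗.πL h) := by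
  rw [projB, LinearMap.comp_apply, LinearEquiv.coe_coe, LinearEquiv.apply_symm_apply, lift_tmul,
    rightEval_apply, rightL_apply]

theorem symm_induction {motive : A → Prop} (zero : motive 0)
    (tmul : ∀ b h, motive (κ.symm (tmul (𝓐.rightL ηL) 𝓗.bimodL.left b h)))
    (add : ∀ x y, motive x → motive y → motive (x + y)) (a : A) : motive a := by
  rw [← κ.symm_apply_apply a]
  generalize κ a = w
  induction w using tensor_induction with
  | zero => rwa [map_zero]
  | add u v hu hv => rw [map_add]; exact add _ _ hu hv
  | tmul b h => exact tmul b h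

include hB in
theorem projB_coinvariant_mul (b : 𝓐.coinvariants) (a : A) :
    projB κ (b * a) = b * projB κ a := by
  induction a using symm_induction κ with
  | zero => simp
  | add u v hu hv => simp only [mul_add, map_add, hu, hv]
  | tmul c h =>
    rw [projB_symm_tmul, symm_tmul κ hB, ← mul_assoc, ← mul_assoc, ← projB_symm_tmul κ,
      symm_tmul κ hB]
    rfl

/-- Colinearity makes κ right L-linear, and π_L(t_L(l) h) = π_L(h) l. -/
theorem projB_actL
    (hc : IsColinear 𝓐.toRightComodule (tensorComodule 𝓗 (𝓐.rightL ηL)) κ.toLinearMap)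
    (l : L) (a : A) : projB κ (𝓐.actL (op l) a) = projB κ a * ηL l := by
  induction a using symm_induction κ with
  | zero => simp
  | add u v hu hv => simp only [add_mul, map_add, hu, hv]
  | tmul b h =>
    have h1 := hc.left.symm.linear l (tmul (𝓐.rightL ηL) 𝓗.bimodL.left b h)
    have h2 : (tensorComodule 𝓗 (𝓐.rightL ηL)).actL (op l) (tmul (𝓐.rightL ηL) 𝓗.bimodL.left b h)
      = tmul (𝓐.rightL ηL) 𝓗.bimodL.left b (𝓗.bimodL.right (op l) h) := rightOn_tmul ..
    rw [h2] at h1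
    refine (congrArg _ h1.symm).trans ?_
    refine (projB_symm_tmul κ _ _).trans ?_
    rw [projB_symm_tmul, 𝓗.left.coring.ε_right, map_mul, mul_assoc]

include hB in
-- The analogue of `sharp_mul` with p in place of ♯, proved without a convolution inverse: for a = b
-- j(h), it reads b η_L(π_L(h₍₁₎)) j(h₍₂₎) = b j(s_L(π_L(h₍₁₎)) h₍₂₎) = b j(h).
theorem projB_mul_cleaving
    (hc : IsColinear 𝓐.toRightComodule (tensorComodule 𝓗 (𝓐.rightL ηL)) κ.toLinearMap)
    (hbal : ∀ a l h, (𝓐.coinvariants.val.toLinearMap ∘ₗ projB κ) (𝓐.actL (op l) a) * cleaving κ h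
      = (𝓐.coinvariants.val.toLinearMap ∘ₗ projB κ) a * cleaving κ (𝓗.bimodL.left l h)) (a : A) :
    mulMap 𝓐.actL 𝓗.bimodL.left (𝓐.coinvariants.val.toLinearMap ∘ₗ projB κ) (cleaving κ) hbal
      (𝓐.coL.ρ a) = a := by
  induction a using symm_induction κ with
  | zero => simp
  | add u v hu hv => simp only [map_add, hu, hv]
  | tmul b h =>
    rw [symm_tmul κ hB, coL_coinvariant_mul, coL_of_colinear (cleaving_colinear κ hc), map_map]
    conv_rhs => rw [← 𝓗.left.coring.counit_left h]
    generalize 𝓗.γL h = z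
    induction z using tensor_induction with
    | zero => simp
    | add u v hu hv => simp only [map_add, mul_add, hu, hv]
    | tmul x y =>
      rw [map_tmul, mulMap_tmul, lift_tmul, leftEval_apply, leftBimod_left, cleaving_sL κ hB,
        ← mul_assoc]
      refine congrArg (· * cleaving κ y) ?_
      change ((projB κ (b * cleaving κ x) : 𝓐.coinvariants) : A) = _
      rw [← symm_tmul κ hB, projB_symm_tmul]
      rfl

/-! ### The convolution inverse obtained from the Galois property -/

variable (hG : 𝓐.IsGalois)

/-- The map `A ⊗_B A → A`, `a ⊗ a' ↦ a p(a')`, for the projection `p : A → B`. -/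
def mulProj : BTensor 𝓐.rightB 𝓐.leftB →ₗ[k] A :=
  mulMap 𝓐.rightB 𝓐.leftB LinearMap.id (𝓐.coinvariants.val.toLinearMap ∘ₗ projB κ)
    fun a b a' => by
      rw [leftB_apply, LinearMap.comp_apply, LinearMap.comp_apply, projB_coinvariant_mul κ hB]
      exact mul_assoc ..

theorem mulProj_tmul (a a' : A) :
    mulProj κ hB (tmul 𝓐.rightB 𝓐.leftB a a') = a * projB κ a' :=
  mulMap_tmul ..

/-- The left `A`-linear map `A ⊗_R H → A` that sends `a⁽⁰⁾ ⊗ a⁽¹⁾` to `p(a)`. -/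
def galoisProj : BTensor 𝓐.actR 𝓗.bimodR.left →ₗ[k] A :=
  mulProj κ hB ∘ₗ (LinearEquiv.ofBijective 𝓐.can hG).symm.toLinearMap

theorem galoisProj_can (w : BTensor 𝓐.rightB 𝓐.leftB) :
    galoisProj κ hB hG (𝓐.can w) = mulProj κ hB w :=
  congrArg (mulProj κ hB) ((LinearEquiv.ofBijective 𝓐.can hG).symm_apply_apply w)

theorem galoisProj_coR (a : A) : galoisProj κ hB hG (𝓐.coR.ρ a) = projB κ a := by
  have h1 := galoisProj_can κ hB hG (tmul 𝓐.rightB 𝓐.leftB 1 a)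
  rwa [can_tmul, mulProj_tmul, one_mul, map_one, Module.End.one_apply] at h1

-- Surjectivity of the canonical map: the elements a ρ_R(a') span A ⊗_R H, so left A-linear maps on
-- it are determined by their values on ρ_R(A).
include hG in
theorem galois_induction {motive : BTensor 𝓐.actR 𝓗.bimodR.left → Prop} (zero : motive 0)
    (coR : ∀ a a', motive (𝓐.leftA a (𝓐.coR.ρ a')))
    (add : ∀ x y, motive x → motive y → motive (x + y)) (w : BTensor 𝓐.actR 𝓗.bimodR.left) :
    motive w := by
  obtain ⟨z, rfl⟩ := hG.2 w
  induction z using tensor_induction with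
  | zero => rwa [map_zero]
  | add u v hu hv => rw [map_add]; exact add _ _ hu hv
  | tmul a a' => rw [can_tmul]; exact coR a a'

theorem galoisProj_leftA (a : A) (w : BTensor 𝓐.actR 𝓗.bimodR.left) :
    galoisProj κ hB hG (𝓐.leftA a w) = a * galoisProj κ hB hG w := by
  induction w using galois_induction hG with
  | zero => simp
  | add u v hu hv => simp only [mul_add, map_add, hu, hv]
  | coR x y =>
    rw [← Module.End.mul_apply, ← map_mul, ← can_tmul, ← can_tmul, galoisProj_can, galoisProj_can,
      mulProj_tmul, mulProj_tmul, mul_assoc]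

/-- The convolution inverse of the cleaving map. -/
def cleavingInv : H →ₗ[k] A := galoisProj κ hB hG ∘ₗ tmul 𝓐.actR 𝓗.bimodR.left 1

theorem galoisProj_tmul (a : A) (h : H) :
    galoisProj κ hB hG (tmul 𝓐.actR 𝓗.bimodR.left a h) = a * cleavingInv κ hB hG h := by
  rw [cleavingInv, LinearMap.comp_apply, ← galoisProj_leftA, leftA_tmul, mul_one]

theorem cleavingInv_isLinearR : 𝓐.IsLinearR (cleavingInv κ hB hG) := by
  intro r h
  rw [← galoisProj_tmul, cleavingInv, LinearMap.comp_apply, ← tmul_mul_ηR, one_mul]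

theorem extend_cleavingInv (w : BTensor 𝓐.actR 𝓗.bimodR.left) :
    extend (cleavingInv_isLinearR κ hB hG) w = galoisProj κ hB hG w :=
  tensor_ext_apply _ _ (fun a h => by rw [extend_tmul, galoisProj_tmul]) w

/-- The characterization of the inverse: by left A-linearity, `galoisProj` is a ⊗ h ↦ a j'(h), hence
its composite with ρ_R is both ♯ and p. -/
theorem sharp_cleavingInv (a : A) : sharp (cleavingInv_isLinearR κ hB hG) a = projB κ a := by
  rw [sharp_apply, extend_cleavingInv, galoisProj_coR]

theorem cleavingInv_tL
    (hc : IsColinear 𝓐.toRightComodule (tensorComodule 𝓗 (𝓐.rightL ηL)) κ.toLinearMap)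
    (l : L) (h : H) :
    cleavingInv κ hB hG (𝓗.left.t (op l) * h) = cleavingInv κ hB hG h * ηL l := by
  -- Right L-linearity is tested on a ρ_R(a'), where it reduces to that of ρ_R and of p.
  have key : ∀ w, galoisProj κ hB hG (rightOn 𝓐.actR 𝓗.bimodRL (op l) w)
      = galoisProj κ hB hG w * ηL l := by
    intro w
    induction w using galois_induction hG with
    | zero => simp
    | add u v hu hv => simp only [add_mul, map_add, hu, hv]
    | coR x y =>
      have h1 : ∀ z, rightOn 𝓐.actR 𝓗.bimodRL (op l) (𝓐.leftA x z)
          = 𝓐.leftA x (rightOn 𝓐.actR 𝓗.bimodRL (op l) z) := by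
        intro z
        induction z using tensor_induction with
        | zero => simp
        | add u v hu hv => simp only [map_add, hu, hv]
        | tmul m n => rw [leftA_tmul, rightOn_tmul, rightOn_tmul, leftA_tmul]
      rw [h1, ← 𝓐.coR_linear, galoisProj_leftA, galoisProj_leftA, galoisProj_coR, galoisProj_coR,
        projB_actL κ hc, mul_assoc]
      rfl
  have h2 := key (tmul 𝓐.actR 𝓗.bimodR.left 1 h)
  rw [rightOn_tmul] at h2
  exact h2

theorem cleavingInv_bimod
    (hc : IsColinear 𝓐.toRightComodule (tensorComodule 𝓗 (𝓐.rightL ηL)) κ.toLinearMap) :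
    𝓐.IsBimoduleMapRL ηL (cleavingInv κ hB hG) := by
  intro l r h
  rw [cleavingInv_isLinearR, cleavingInv_tL κ hB hG hc, mul_assoc]

theorem cleavingInv_isConvolutionInverse
    (hc : IsColinear 𝓐.toRightComodule (tensorComodule 𝓗 (𝓐.rightL ηL)) κ.toLinearMap) :
    𝓐.IsConvolutionInverse ηL (cleaving κ) (cleavingInv κ hB hG) where
  bimod := cleaving_bimod κ hB hc
  bimod' := cleavingInv_bimod κ hB hG hc
  right_inv h := by
    have h1 : (projB κ (cleaving κ h) : A) = ηL (𝓗.πL h) := by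
      rw [cleaving_apply, projB_symm_tmul, one_mul]
    -- Since j is colinear, (j * j')(h) is `galoisProj` evaluated at ρ_R(j(h)), that is, p(j(h)).
    rw [← h1, ← galoisProj_coR κ hB hG, coR_of_colinear (cleaving_colinear κ hc)]
    refine tensor_ext_apply _ (galoisProj κ hB hG ∘ₗ map (cleaving κ) LinearMap.id _ _)
      (fun x y => ?_) (𝓗.γR h)
    rw [LinearMap.comp_apply, map_tmul, galoisProj_tmul, mulMap_tmul, LinearMap.id_apply]
  left_inv h := by
    have hbal := conv_balanced_L (cleaving_bimod κ hB hc) (cleavingInv_bimod κ hB hG hc)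
    have hlin := cleavingInv_isLinearR κ hB hG
    have hε : 𝓐.IsLinearR (𝓐.ηR.toLinearMap ∘ₗ 𝓗.πR) := by
      intro r h
      have := 𝓗.right.coring.ε_left r h
      rw [rightBimod_left] at this
      simp [this]
    have hsharp : 𝓐.coinvariants.val.toLinearMap ∘ₗ projB κ = sharp hlin :=
      LinearMap.ext fun a => (sharp_cleavingInv κ hB hG a).symm
    -- With ♯ = p this is `projB_mul_cleaving` read through `sharp_mul_coL`.
    have h1 : ∀ a, extend (hlin.convL hbal) (𝓐.coR.ρ a) = a := by
      intro a
      rw [← sharp_mul_coL hlin hbal]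
      have h2 := projB_mul_cleaving κ hB hc
      simp only [hsharp] at h2
      exact h2 (sharp_actL_mul hlin hbal) a
    -- Both left A-linear maps restrict to the identity along ρ_R, so they agree everywhere;
    -- evaluation at 1 ⊗ h then gives j' * j = η_R π_R.
    have h3 : ∀ w, extend (hlin.convL hbal) w = extend hε w := by
      intro w
      induction w using galois_induction hG with
      | zero => simp
      | add u v hu hv => simp only [map_add, hu, hv]
      | coR a a' => rw [extend_leftA, extend_leftA, h1, extend_counit hε fun _ => rfl]
    have h4 := h3 (tmul 𝓐.actR 𝓗.bimodR.left 1 h)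
    rw [extend_tmul, extend_tmul, one_mul, one_mul] at h4
    exact h4

end NormalBasis

/-! ### The equivalence for a fixed L-ring structure, and the theorem -/

theorem isCleftVia_iff (ηL : L →ₐ[k] 𝓐.coinvariants) :
    𝓐.IsCleftVia ηL ↔ 𝓐.IsGalois ∧ 𝓐.HasNormalBasis ηL := by
  constructor
  · rintro ⟨j, hj⟩
    obtain ⟨j', c⟩ := hj.invertible
    exact ⟨c.isGalois hj.colinear, c.hasNormalBasis hj.colinear⟩
  · rintro ⟨hG, κ, hB, hc⟩
    exact ⟨cleaving κ, cleaving_sL κ hB, cleaving_colinear κ hc, cleavingInv κ hB hG,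
      cleavingInv_isConvolutionInverse κ hB hG hc⟩

end ComoduleAlgebra
end HopfCleft
end

theorem mainTheorem1 {k L R H A : Type*} [CommRing k]
    [Ring L] [Algebra k L] [Ring R] [Algebra k R] [Ring H] [Algebra k H] [Ring A] [Algebra k A]
    (𝓗 : HopfCleft.HopfAlgebroid k L R H) (𝓐 : HopfCleft.ComoduleAlgebra 𝓗 A) :
    (𝓐.IsCleft ↔ 𝓐.IsGalois ∧ ∃ ηL : L →ₐ[k] 𝓐.coinvariants, 𝓐.HasNormalBasis ηL) ∧
      ∀ ηL : L →ₐ[k] 𝓐.coinvariants,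
        𝓐.IsCleftVia ηL ↔ 𝓐.IsGalois ∧ 𝓐.HasNormalBasis ηL := by
  refine ⟨?_, HopfCleft.ComoduleAlgebra.isCleftVia_iff⟩
  -- The Galois condition does not involve η_L, so it can be taken out of the existential
  -- quantifier.
  simp only [HopfCleft.ComoduleAlgebra.IsCleft, HopfCleft.ComoduleAlgebra.isCleftVia_iff,
    exists_and_left]
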